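/- Let $P$ be a finite poset. In $\mathbb{R}^P$ let the order polytope $\mathcal{O}(P)$ be the set of all $(a_x)_{x\in P}$ with $0\le a_x\le 1$ for all $x$ and $a_x\ge a_y$ whenever $x\le y$ in $P$, and let the chain polytope $\mathcal{C}(P)$ be the set of all $(a_x)_{x\in P}$ with $a_x\ge 0$ for all $x$ and $\sum_{x\in S}a_x\le 1$ for every maximal chain $S$ of $P$. Let $X$ be the five-element poset $\{a,b,c,d,e\}$ with covering relations $d<a$, $e<a$, $a<b$, $a<c$ (so $b,c$ are incomparable, and so are $d,e$). Then the following conditions are equivalent: (i) $\mathcal{O}(P)$ and $\mathcal{C}(P)$ are unimodularly equivalent, i.e. there are an integral matrix $U$ with $\det U=\pm1$ and an integral vector $w$ such that $\mathcal{C}(P)=\{vU+w : v\in\mathcal{O}(P)\}$; (ii) $\mathcal{O}(P)$ and $\mathcal{C}(P)$ are affinely equivalent, i.e. $\mathcal{C}(P)=\varphi(\mathcal{O}(P))$ for some invertible affine map $\varphi:\mathbb{R}^P\to\mathbb{R}^P$; (iii) $\mathcal{O}(P)$ and $\mathcal{C}(P)$ have the same $f$-vector $(f_0,\dots,f_{d-1})$,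 where $d=|P|$ is the dimension of both polytopes and $f_i$ is the number of $i$-dimensional faces; (iv) $\mathcal{O}(P)$ and $\mathcal{C}(P)$ have the same number of facets; (v) the $1$-skeletons of $\mathcal{O}(P)$ and $\mathcal{C}(P)$ (the finite simple graphs formed by the vertices and edges of the polytopes) have the same degree sequence, i.e. the same list of vertex degrees arranged in weakly increasing order; (vi) $X$ does not appear as a subposet of $P$, i.e. no subset of $P$ with the induced order is isomorphic to $X$. -/

import Mathlib

/-! ### Order polytopes and chain polytopes

The coordinates of the ambient space are indexed by the elements of the poset. -/

section Polytopes

/-- The order polytope of a poset `P`: all `a` with `0 ≤ a i ≤ 1` for every `i`, and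
`a i ≥ a j` whenever `i ≤ j`. -/
def orderPolytope (P : Type*) [PartialOrder P] : Set (P → ℝ) :=
  {a | (∀ i, 0 ≤ a i ∧ a i ≤ 1) ∧ ∀ i j, i ≤ j → a i ≥ a j}

/-- The chain polytope of a (finite) poset `P`: all `a` with `a i ≥ 0` for every `i`, and
`∑ i ∈ s, a i ≤ 1` for every maximal chain `s`. -/
def chainPolytope (P : Type*) [PartialOrder P] : Set (P → ℝ) :=
  {a | (∀ i, a i ≥ 0) ∧
    ∀ s : Finset P, IsMaxChain (fun x y : P => x ≤ y) (s : Set P) → ∑ i ∈ s, a i ≤ 1}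

/-! ### Equivalence of polytopes -/

/-- `Q = f_U(K) + w` for an integral matrix `U` with `det U = ± 1` and an integral vector `w`,
where `f_U v = v U` (row vector times matrix). -/
def UnimodularlyEquivalent {ι : Type*} [Fintype ι] [DecidableEq ι] (K Q : Set (ι → ℝ)) : Prop :=
  ∃ (U : Matrix ι ι ℤ) (w : ι → ℤ), (U.det = 1 ∨ U.det = -1) ∧
    Q = (fun v : ι → ℝ =>
      Matrix.vecMul v (U.map (fun z : ℤ => (z : ℝ))) + fun i => (w i : ℝ)) '' K

/-- `Q` is the image of `K` under an affine automorphism of the ambient space. -/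
def AffinelyEquivalent {ι : Type*} (K Q : Set (ι → ℝ)) : Prop :=
  ∃ φ : (ι → ℝ) ≃ᵃ[ℝ] (ι → ℝ), Q = φ '' K

/-! ### Faces, `f`-vectors and facets -/

/-- The dimension of the affine hull of a (nonempty) set. -/
noncomputable def polytopeDim {ι : Type*} (K : Set (ι → ℝ)) : ℕ :=
  Module.finrank ℝ (vectorSpan ℝ K)

/-- `F` is a nonempty face of `K`: the set of points of `K` at which some linear functional
attains its maximum over `K`. (The zero functional yields `K` itself.) -/
def IsPolytopeFace {ι : Type*} (K F : Set (ι → ℝ)) : Prop :=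
  F.Nonempty ∧ IsExposed ℝ K F

/-- The number `f_i` of `i`-dimensional faces. -/
noncomputable def faceNumber {ι : Type*} (K : Set (ι → ℝ)) (i : ℕ) : ℕ :=
  {F : Set (ι → ℝ) | IsPolytopeFace K F ∧ polytopeDim F = i}.ncard

/-- The `f`-vector `(f_0, f_1, …, f_{d-1})`, where `d` is the dimension. -/
noncomputable def fVector {ι : Type*} (K : Set (ι → ℝ)) : List ℕ :=
  (List.range (polytopeDim K)).map (faceNumber K)

/-- The number of facets, i.e. of faces `F` with `dim F = dim K - 1`. -/
noncomputable def facetNumber {ι : Type*} (K : Set (ι → ℝ)) : ℕ :=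
  {F : Set (ι → ℝ) | IsPolytopeFace K F ∧ polytopeDim F + 1 = polytopeDim K}.ncard

/-! ### The 1-skeleton and its degree sequence -/

/-- The vertices: the points `v` for which `{v}` is a face. -/
def polytopeVertices {ι : Type*} (K : Set (ι → ℝ)) : Set (ι → ℝ) :=
  {v | IsPolytopeFace K {v}}

/-- The 1-skeleton: the simple graph on the vertices in which two distinct vertices are
adjacent when the segment joining them is a face (an edge). -/
def oneSkeleton {ι : Type*} (K : Set (ι → ℝ)) : SimpleGraph (polytopeVertices K) where
  Adj u v := u ≠ v ∧ IsPolytopeFace K (segment ℝ (u : ι → ℝ) (v : ι → ℝ))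
  symm := ⟨fun u v h => ⟨h.1.symm, by rw [segment_symm]; exact h.2⟩⟩
  loopless := ⟨fun _ h => h.1 rfl⟩

open Classical in
/-- The degrees of the vertices of a finite simple graph, listed (with multiplicity) in weakly
increasing order. -/
noncomputable def degreeSequence {V : Type*} [Finite V] (G : SimpleGraph V) : List ℕ :=
  letI : Fintype V := Fintype.ofFinite V
  ((Finset.univ : Finset V).val.map fun v => G.degree v).sort (fun m n => m ≤ n)

/-- A set cut out by finitely many linear inequalities has finitely many vertices. -/
theorem finite_polytopeVertices {ι J : Type*} [Finite J]
    (l : J → ((ι → ℝ) →ₗ[ℝ] ℝ)) (c : J → ℝ) :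
    (polytopeVertices {x : ι → ℝ | ∀ j, l j x ≤ c j}).Finite := by
  classical
  set K : Set (ι → ℝ) := {x | ∀ j, l j x ≤ c j} with hK
  refine Set.Finite.of_finite_image (f := fun x => {j : J | l j x = c j}) (Set.toFinite _) ?_
  intro u hu v hv huv
  have huv' : ∀ j, l j u = c j ↔ l j v = c j := fun j => by
    have := Set.ext_iff.1 huv j
    simpa using this
  have huK : u ∈ K := hu.2.subset rfl
  have hvK : v ∈ K := hv.2.subset rfl
  -- a common small step
  have key : ∀ᶠ t : ℝ in nhdsWithin 0 (Set.Ioi 0), v + t • (v - u) ∈ K := by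
    have : ∀ j, ∀ᶠ t : ℝ in nhdsWithin 0 (Set.Ioi 0), l j (v + t • (v - u)) ≤ c j := by
      intro j
      rcases (hvK j).eq_or_lt with h | h
      · refine Filter.Eventually.of_forall fun t => ?_
        have h2 := (huv' j).2 h
        simp [h, h2]
      · have hc : Filter.Tendsto (fun t : ℝ => l j v + t * (l j v - l j u))
            (nhdsWithin 0 (Set.Ioi 0)) (nhds (l j v)) := by
          have : Continuous fun t : ℝ => l j v + t * (l j v - l j u) := by fun_prop
          have h3 := (this.tendsto 0).mono_left (nhdsWithin_le_nhds (s := Set.Ioi 0))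
          simpa using h3
        filter_upwards [hc.eventually (gt_mem_nhds h)] with t ht
        simpa using ht.le
    exact (Filter.eventually_all.2 this).mono fun t ht => ht
  obtain ⟨t, htK, ht⟩ := (key.and self_mem_nhdsWithin).exists
  have ht : (0 : ℝ) < t := ht
  have hext := hv.2.isExtreme
  have hmem : v ∈ openSegment ℝ u (v + t • (v - u)) := by
    refine ⟨t / (1 + t), 1 / (1 + t), by positivity, by positivity, by field_simp; ring, ?_⟩
    ext i
    simp only [Pi.add_apply, Pi.smul_apply, Pi.sub_apply, smul_eq_mul]
    field_simp
    ring
  exact hext.left_mem_of_mem_openSegment huK htK rfl hmem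

/-- The vertices of an order polytope are finite in number. -/
instance finite_vertices_orderPolytope (P : Type*) [PartialOrder P] [Finite P] :
    Finite (polytopeVertices (orderPolytope P)) := by
  have h := finite_polytopeVertices (ι := P) (J := (P ⊕ P) ⊕ {p : P × P // p.1 ≤ p.2})
    (Sum.elim (Sum.elim (fun i => -LinearMap.proj i) (fun i => LinearMap.proj i))
      (fun p => LinearMap.proj (R := ℝ) (φ := fun _ : P => ℝ) p.1.2 -
        LinearMap.proj (R := ℝ) (φ := fun _ : P => ℝ) p.1.1))
    (Sum.elim (Sum.elim (fun _ => 0) (fun _ => 1)) (fun _ => 0))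
  refine (?_ : (polytopeVertices (orderPolytope P)).Finite)
  convert h using 2
  ext a
  simp [orderPolytope, forall_and]

/-- The vertices of a chain polytope are finite in number. -/
instance finite_vertices_chainPolytope (P : Type*) [PartialOrder P] [Finite P] :
    Finite (polytopeVertices (chainPolytope P)) := by
  have h := finite_polytopeVertices (ι := P)
    (J := P ⊕ {s : Finset P // IsMaxChain (fun x y : P => x ≤ y) (s : Set P)})
    (Sum.elim (fun i => -LinearMap.proj i) (fun s => ∑ i ∈ s.1, LinearMap.proj i))
    (Sum.elim (fun _ => 0) (fun _ => 1))
  refine (?_ : (polytopeVertices (chainPolytope P)).Finite)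
  convert h using 2
  ext a
  simp [chainPolytope]

end Polytopes

/-! ### The five-element poset `X` -/

/-- The elements of the poset `X`: a middle element `a`, two elements `b`, `c` above it and
two elements `d`, `e` below it. -/
inductive PosetX : Type
  | a | b | c | d | e

/-- The height of an element of `X` in its Hasse diagram. -/
def PosetX.height : PosetX → ℕ
  | .d => 0
  | .e => 0
  | .a => 1
  | .b => 2
  | .c => 2

/-- The order with covering relations `d < a`, `e < a`, `a < b`, `a < c`; the elements `b`, `c`
are incomparable and so are `d`, `e`. -/
instance : PartialOrder PosetX where
  le x y := x = y ∨ x.height < y.height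
  le_refl _ := Or.inl rfl
  le_trans x y z := by
    rintro (rfl | h) (rfl | h')
    · exact Or.inl rfl
    · exact Or.inr h'
    · exact Or.inr h
    · exact Or.inr (h.trans h')
  le_antisymm x y := by
    rintro (rfl | h) (h' | h')
    · rfl
    · rfl
    · exact h'.symm
    · exact absurd (h.trans h') (lt_irrefl _)

/-! Affine automorphisms carry faces to faces and preserve dimension, so (i) ⇒ (ii) ⇒ (iii) ⇒ (iv)
and (ii) ⇒ (v) are formal. The content is (vi) ⇒ (i), and that an occurrence of `X` refutes both
(iv) and (v). Throughout, `X` occurs iff some element has two incomparable elements below it and two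
above it.

If `X` does not occur, every element has a chain below it or a chain above it. Put `a x = 1 - ∑_{z ≤
x} y z` if the elements below `x` form a chain, and `a x = ∑_{z ≥ x} y z` otherwise. This integral
affine map is triangular with diagonal entries `±1`, and it identifies the chain polytope with the
order polytope (`det_chainToOrderMatrix`, `mem_chainPolytope_iff_mem_orderPolytope`).

Facets: the order polytope has at most one for each minimal element, maximal element and cover
relation; the chain polytope has exactly one for each element and each maximal chain. Choosing an
upper cover of each non-maximal element gives an injection from the first list to the second, which
misses a maximal chain when `X` occurs (`card_min_max_covBy_lt`).

Degrees: the origin, a vertex of the chain polytope, has only unit vectors as neighbours, hence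
degree at most `|P|`. A vertex of the order polytope is the indicator of a lower set `I`, and adding
or removing a connected piece of `P` moves along an edge. Each element supplies one such piece, and
an occurrence of `X` supplies one more, so every degree exceeds `|P|`. -/

/-! ### Faces, their dimensions and 1-skeletons under affine automorphisms -/

section PolytopeFaces

variable {ι : Type*}

theorem isPolytopeFace_iff_exists_linearMap [Finite ι] {K F : Set (ι → ℝ)} :
    IsPolytopeFace K F ↔ F.Nonempty ∧
      ∃ l : (ι → ℝ) →ₗ[ℝ] ℝ, F = {x | x ∈ K ∧ ∀ y ∈ K, l y ≤ l x} := by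
  constructor
  · rintro ⟨hF, hex⟩
    obtain ⟨l, hl⟩ := hex hF
    exact ⟨hF, l.toLinearMap, hl⟩
  · rintro ⟨hF, l, hl⟩
    exact ⟨hF, fun _ => ⟨LinearMap.toContinuousLinearMap l, hl⟩⟩

/-- The points of `K` where a valid linear inequality is tight form a face. -/
theorem isPolytopeFace_of_linearMap_le [Finite ι] {K F : Set (ι → ℝ)} (hF : F.Nonempty)
    (l : (ι → ℝ) →ₗ[ℝ] ℝ) (c : ℝ) (hl : ∀ x ∈ K, l x ≤ c)
    (h : ∀ x, x ∈ F ↔ x ∈ K ∧ l x = c) : IsPolytopeFace K F := by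
  refine isPolytopeFace_iff_exists_linearMap.2 ⟨hF, l, ?_⟩
  obtain ⟨z, hz⟩ := hF
  have hz' := (h z).1 hz
  ext x
  rw [h x]
  refine and_congr_right fun hx => ⟨fun hxc y hy => hxc ▸ hl y hy, fun hmax => ?_⟩
  exact le_antisymm (hl x hx) (hz'.2 ▸ hmax z hz'.1)

/-- The points of `K` where finitely many valid linear inequalities are tight form a face. -/
theorem isPolytopeFace_of_forall_linearMap_le [Finite ι] {J : Type*} [Fintype J]
    {K F : Set (ι → ℝ)} (hF : F.Nonempty)
    (l : J → (ι → ℝ) →ₗ[ℝ] ℝ) (c : J → ℝ) (hl : ∀ j, ∀ x ∈ K, l j x ≤ c j)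
    (h : ∀ x, x ∈ F ↔ x ∈ K ∧ ∀ j, l j x = c j) : IsPolytopeFace K F := by
  refine isPolytopeFace_of_linearMap_le hF (∑ j, l j) (∑ j, c j) (fun x hx => ?_) fun x => ?_
  · simpa using Finset.sum_le_sum fun j _ => hl j x hx
  · rw [h x]
    refine and_congr_right fun hx => ?_
    have := Finset.sum_eq_sum_iff_of_le (s := Finset.univ) fun j _ => hl j x hx
    simpa using this.symm

theorem isPolytopeFace_image [Finite ι] (φ : (ι → ℝ) ≃ᵃ[ℝ] (ι → ℝ)) {K F : Set (ι → ℝ)}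
    (h : IsPolytopeFace K F) : IsPolytopeFace (φ '' K) (φ '' F) := by
  obtain ⟨hF, l, hl⟩ := isPolytopeFace_iff_exists_linearMap.1 h
  refine isPolytopeFace_iff_exists_linearMap.2
    ⟨hF.image _, l ∘ₗ (φ.symm.linear : (ι → ℝ) →ₗ[ℝ] (ι → ℝ)), ?_⟩
  have key : ∀ x y : ι → ℝ, (l ∘ₗ (φ.symm.linear : (ι → ℝ) →ₗ[ℝ] (ι → ℝ))) (φ y) ≤
      (l ∘ₗ (φ.symm.linear : (ι → ℝ) →ₗ[ℝ] (ι → ℝ))) (φ x) ↔ l y ≤ l x := by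
    intro x y
    have h1 := φ.symm.toAffineMap.linearMap_vsub (φ x) (φ y)
    simp only [vsub_eq_sub, AffineEquiv.linear_toAffineMap, AffineEquiv.coe_toAffineMap,
      AffineEquiv.symm_apply_apply] at h1
    rw [← sub_nonneg, ← map_sub, LinearMap.comp_apply, h1, map_sub, sub_nonneg]
  ext z
  constructor
  · rintro ⟨x, hx, rfl⟩
    rw [hl] at hx
    refine ⟨⟨x, hx.1, rfl⟩, ?_⟩
    rintro _ ⟨y, hy, rfl⟩
    exact (key x y).2 (hx.2 y hy)
  · rintro ⟨⟨x, hx, rfl⟩, hmax⟩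
    refine ⟨x, ?_, rfl⟩
    rw [hl]
    exact ⟨hx, fun y hy => (key x y).1 (hmax _ ⟨y, hy, rfl⟩)⟩

theorem isPolytopeFace_image_iff [Finite ι] (φ : (ι → ℝ) ≃ᵃ[ℝ] (ι → ℝ)) {K F : Set (ι → ℝ)} :
    IsPolytopeFace (φ '' K) (φ '' F) ↔ IsPolytopeFace K F := by
  refine ⟨fun h => ?_, isPolytopeFace_image φ⟩
  have := isPolytopeFace_image φ.symm h
  simpa [Set.image_image] using this

theorem polytopeDim_image (φ : (ι → ℝ) ≃ᵃ[ℝ] (ι → ℝ)) (K : Set (ι → ℝ)) :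
    polytopeDim (φ '' K) = polytopeDim K := by
  have h := φ.toAffineMap.map_vectorSpan (s := K)
  have h2 := φ.linear.finrank_map_eq (vectorSpan ℝ K)
  rw [polytopeDim, polytopeDim, ← h2]
  exact congrArg (fun S : Submodule ℝ (ι → ℝ) => Module.finrank ℝ S) h.symm

theorem faceNumber_image [Finite ι] (φ : (ι → ℝ) ≃ᵃ[ℝ] (ι → ℝ)) (K : Set (ι → ℝ)) (i : ℕ) :
    faceNumber (φ '' K) i = faceNumber K i := by
  have h : {F | IsPolytopeFace (φ '' K) F ∧ polytopeDim F = i} =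
      (fun F => φ '' F) '' {F | IsPolytopeFace K F ∧ polytopeDim F = i} := by
    ext F
    constructor
    · rintro ⟨hF, hd⟩
      have hF' : φ '' (φ.symm '' F) = F := by
        rw [Set.image_image]; simp only [AffineEquiv.apply_symm_apply, Set.image_id']
      refine ⟨φ.symm '' F, ⟨?_, ?_⟩, hF'⟩
      · rw [← hF'] at hF
        exact (isPolytopeFace_image_iff φ).1 hF
      · rw [polytopeDim_image, hd]
    · rintro ⟨G, ⟨hG, hd⟩, rfl⟩
      exact ⟨isPolytopeFace_image φ hG, (polytopeDim_image φ G).trans hd⟩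
  rw [faceNumber, h, Set.ncard_image_of_injective _ φ.injective.image_injective, faceNumber]

theorem fVector_image [Finite ι] (φ : (ι → ℝ) ≃ᵃ[ℝ] (ι → ℝ)) (K : Set (ι → ℝ)) :
    fVector (φ '' K) = fVector K := by
  simp only [fVector, polytopeDim_image]
  exact List.map_congr_left fun i _ => faceNumber_image φ K i

theorem AffinelyEquivalent.fVector_eq [Finite ι] {K Q : Set (ι → ℝ)}
    (h : AffinelyEquivalent K Q) : fVector K = fVector Q := by
  obtain ⟨φ, rfl⟩ := h
  exact (fVector_image φ K).symm

/-- The length of the `f`-vector is the dimension, so equal `f`-vectors force equal dimensions, and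
the last entry counts facets. In dimension 0 the list is empty and there are no facets. -/
theorem facetNumber_eq_of_fVector_eq {K Q : Set (ι → ℝ)} (h : fVector K = fVector Q) :
    facetNumber K = facetNumber Q := by
  have hlen : polytopeDim K = polytopeDim Q := by
    simpa [fVector] using congrArg List.length h
  rcases Nat.eq_zero_or_pos (polytopeDim K) with h0 | h0
  · simp [facetNumber, ← hlen, h0]
  · obtain ⟨n, hn⟩ := Nat.exists_eq_succ_of_ne_zero h0.ne'
    have hn' : polytopeDim Q = n + 1 := hlen ▸ hn
    have : faceNumber K n = faceNumber Q n := by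
      have h1 := congrArg (fun L => L[n]?) h
      simpa [fVector, hn, hn'] using h1
    simpa [facetNumber, faceNumber, hn, hn'] using this

theorem UnimodularlyEquivalent.affinelyEquivalent [Fintype ι] [DecidableEq ι]
    {K Q : Set (ι → ℝ)} (h : UnimodularlyEquivalent K Q) : AffinelyEquivalent K Q := by
  obtain ⟨U, w, hU, rfl⟩ := h
  set M : Matrix ι ι ℝ := U.map (fun z : ℤ => (z : ℝ)) with hM
  have hdet : M.det = (U.det : ℝ) := (Int.cast_det U).symm
  have hunit : IsUnit M.det := by
    rcases hU with h | h <;> simp [hdet, h]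
  have hunit' : IsUnit M.transpose.det := by rwa [Matrix.det_transpose]
  -- The transpose appears because vectors are rows: `v M = Mᵀ v`.
  refine ⟨(Matrix.toLinearEquiv' M.transpose (Matrix.invertibleOfIsUnitDet _ hunit')).toAffineEquiv.trans
    (AffineEquiv.constVAdd ℝ (ι → ℝ) fun i => (w i : ℝ)), ?_⟩
  refine Set.image_congr fun v _ => ?_
  simp [Matrix.toLinearEquiv', add_comm]

/-- The isomorphism of 1-skeletons induced by an affine automorphism. -/
noncomputable def oneSkeletonImageIso [Finite ι] (φ : (ι → ℝ) ≃ᵃ[ℝ] (ι → ℝ)) (K : Set (ι → ℝ)) :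
    oneSkeleton K ≃g oneSkeleton (φ '' K) where
  toEquiv := φ.toEquiv.subtypeEquiv fun v => by
    have := isPolytopeFace_image_iff φ (K := K) (F := {v})
    rw [Set.image_singleton] at this
    exact this.symm
  map_rel_iff' := by
    intro u v
    have h : segment ℝ (φ u.1) (φ v.1) = φ '' segment ℝ u.1 v.1 :=
      (image_segment ℝ φ.toAffineMap u.1 v.1).symm
    refine and_congr (Equiv.injective _).ne_iff ?_
    change IsPolytopeFace (φ '' K) (segment ℝ (φ u.1) (φ v.1)) ↔ _
    rw [h, isPolytopeFace_image_iff]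

theorem degreeSequence_eq_of_iso {V W : Type*} [Finite V] [Finite W] {G : SimpleGraph V}
    {H : SimpleGraph W} (e : G ≃g H) : degreeSequence G = degreeSequence H := by
  classical
  unfold degreeSequence
  congr 1
  let : Fintype V := Fintype.ofFinite V
  let : Fintype W := Fintype.ofFinite W
  have h : (Finset.univ : Finset W) = Finset.univ.map e.toEquiv.toEmbedding := by simp
  rw [h, Finset.map_val, Multiset.map_map]
  refine Multiset.map_congr rfl fun v _ => ?_
  exact (e.degree_eq v).symm

theorem AffinelyEquivalent.degreeSequence_eq [Finite ι] {K Q : Set (ι → ℝ)}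
    [Finite (polytopeVertices K)] [Finite (polytopeVertices Q)] (h : AffinelyEquivalent K Q) :
    degreeSequence (oneSkeleton K) = degreeSequence (oneSkeleton Q) := by
  obtain ⟨φ, rfl⟩ := h
  exact degreeSequence_eq_of_iso (oneSkeletonImageIso φ K)

end PolytopeFaces

/-! ### Occurrences of `X` as a local condition at one element -/

section PosetX

variable {P : Type*} [PartialOrder P]

theorem not_isChain_iff_exists_incomparable {s : Set P} :
    ¬ IsChain (· ≤ ·) s ↔ ∃ x ∈ s, ∃ y ∈ s, ¬ x ≤ y ∧ ¬ y ≤ x := by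
  constructor
  · intro h
    by_contra! hcon
    refine h fun x hx y hy _ => ?_
    by_cases hxy : x ≤ y
    · exact Or.inl hxy
    · exact Or.inr (hcon x hx y hy hxy)
  · rintro ⟨x, hx, y, hy, hxy, hyx⟩ h
    rcases h.total hx hy with h | h
    · exact hxy h
    · exact hyx h

theorem nonempty_posetX_orderEmbedding_iff :
    Nonempty (PosetX ↪o P) ↔
      ∃ a : P, ¬ IsChain (· ≤ ·) (Set.Iio a) ∧ ¬ IsChain (· ≤ ·) (Set.Ioi a) := by
  simp only [not_isChain_iff_exists_incomparable]
  have hle : ∀ x y : PosetX, x ≤ y ↔ x = y ∨ x.height < y.height := fun _ _ => Iff.rfl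
  constructor
  · rintro ⟨f⟩
    have hlt : ∀ {x y : PosetX}, x.height < y.height → f x < f y := fun {x y} h =>
      f.strictMono (lt_of_le_not_ge (Or.inr h) fun h' => by
        rcases h' with h' | h'
        · subst h'; exact lt_irrefl _ h
        · exact lt_asymm h h')
    refine ⟨f .a, ⟨f .d, hlt (by decide), f .e, hlt (by decide), ?_, ?_⟩,
      ⟨f .b, hlt (by decide), f .c, hlt (by decide), ?_, ?_⟩⟩ <;>
    · rw [f.le_iff_le, hle]
      simp [PosetX.height]
  · rintro ⟨a, ⟨d, hd, e, he, hde, hed⟩, ⟨b, hb, c, hc, hbc, hcb⟩⟩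
    have hd : d < a := hd
    have he : e < a := he
    have hb : a < b := hb
    have hc : a < c := hc
    let f : PosetX → P := fun x => match x with
      | .a => a | .b => b | .c => c | .d => d | .e => e
    refine ⟨OrderEmbedding.ofMapLEIff f fun x y => ?_⟩
    rw [hle]
    cases x <;> cases y <;>
      simp [f, PosetX.height, hd.le, he.le, hb.le, hc.le, hd.not_ge, he.not_ge, hb.not_ge,
        hc.not_ge, hde, hed, hbc, hcb, (hd.trans hb).le, (hd.trans hc).le, (he.trans hb).le,
        (he.trans hc).le, (hd.trans hb).not_ge, (hd.trans hc).not_ge, (he.trans hb).not_ge,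
        (he.trans hc).not_ge]

end PosetX

/-! ### The unimodular map when `X` does not occur -/

section Unimodular

/-- The explicit map goes from the chain polytope to the order polytope; its inverse `v ↦ v V⁻¹ - w
V⁻¹` is again integral because `det V = ±1`. -/
theorem unimodularlyEquivalent_of_mem_iff {ι : Type*} [Fintype ι] [DecidableEq ι]
    {K Q : Set (ι → ℝ)} (V : Matrix ι ι ℤ) (w : ι → ℤ) (hV : V.det = 1 ∨ V.det = -1)
    (h : ∀ y : ι → ℝ, y ∈ Q ↔
      Matrix.vecMul y (V.map (fun z : ℤ => (z : ℝ))) + (fun i => (w i : ℝ)) ∈ K) :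
    UnimodularlyEquivalent K Q := by
  have hu : IsUnit V.det := Int.isUnit_iff.2 hV
  have hVU : V * V⁻¹ = 1 := Matrix.mul_nonsing_inv V hu
  have hcast : ∀ A B : Matrix ι ι ℤ, A * B = 1 →
      A.map (fun z : ℤ => (z : ℝ)) * B.map (fun z : ℤ => (z : ℝ)) = 1 := by
    intro A B hAB
    have h1 := Matrix.map_mul (L := A) (M := B) (f := Int.castRingHom ℝ)
    rw [hAB] at h1
    have h2 : (1 : Matrix ι ι ℤ).map (Int.castRingHom ℝ) = 1 :=
      Matrix.map_one _ (map_zero _) (map_one _)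
    exact h1.symm.trans h2
  have h1 := hcast _ _ hVU
  have h2 := hcast _ _ (Matrix.nonsing_inv_mul V hu)
  have hw : ∀ U : Matrix ι ι ℤ, (fun i => ((-(Matrix.vecMul w U)) i : ℝ)) =
      -(Matrix.vecMul (fun i => (w i : ℝ)) (U.map (fun z : ℤ => (z : ℝ)))) := by
    intro U
    ext i
    simp [Matrix.vecMul, dotProduct]
  refine ⟨V⁻¹, -(Matrix.vecMul w V⁻¹), ?_, ?_⟩
  · have h3 := congrArg Matrix.det hVU
    rw [Matrix.det_mul, Matrix.det_one] at h3
    rcases hV with h | h <;> rw [h] at h3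
    · left; linarith
    · right; linarith
  · ext y
    have e := hw V⁻¹
    simp only [Pi.neg_apply] at e
    rw [h y]
    constructor
    · intro hy
      refine ⟨_, hy, ?_⟩
      simp only [Pi.neg_apply]
      rw [e, Matrix.add_vecMul, Matrix.vecMul_vecMul, h1, Matrix.vecMul_one, add_neg_cancel_right]
    · rintro ⟨v, hv, rfl⟩
      simp only [Pi.neg_apply]
      rw [e, Matrix.add_vecMul, Matrix.neg_vecMul, Matrix.vecMul_vecMul, Matrix.vecMul_vecMul, h2,
        Matrix.vecMul_one, Matrix.vecMul_one, neg_add_cancel_right]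
      exact hv

variable {P : Type*} [PartialOrder P]

theorem sum_le_one_of_mem_chainPolytope [Finite P] {a : P → ℝ} (ha : a ∈ chainPolytope P)
    {s : Finset P} (hs : IsChain (· ≤ ·) (s : Set P)) : ∑ i ∈ s, a i ≤ 1 := by
  obtain ⟨M, hM, hsM⟩ := hs.exists_maxChain
  have hfin := Set.toFinite M
  calc ∑ i ∈ s, a i ≤ ∑ i ∈ hfin.toFinset, a i :=
        Finset.sum_le_sum_of_subset_of_nonneg (fun i hi => by simpa using hsM hi)
          fun i _ _ => ha.1 i
    _ ≤ 1 := ha.2 _ (by simpa using hM)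

theorem isChain_Iic_of_isChain_Iio {x : P} (h : IsChain (· ≤ ·) (Set.Iio x)) :
    IsChain (· ≤ ·) (Set.Iic x) := by
  rw [← Set.Iio_insert]
  exact h.insert fun b hb _ => Or.inr (le_of_lt hb)

theorem isChain_Ici_of_isChain_Ioi {x : P} (h : IsChain (· ≤ ·) (Set.Ioi x)) :
    IsChain (· ≤ ·) (Set.Ici x) := by
  rw [← Set.Ioi_insert]
  exact h.insert fun b hb _ => Or.inl (le_of_lt hb)

open Classical in
/-- The elements with a chain below them get minus the sum over their principal lower set, the
others the sum over their principal upper set. -/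
noncomputable def chainToOrderMatrix (P : Type*) [PartialOrder P] : Matrix P P ℤ := fun y x =>
  if IsChain (· ≤ ·) (Set.Iio x) then (if y ≤ x then -1 else 0) else (if x ≤ y then 1 else 0)

open Classical in
/-- The translation part accompanying `chainToOrderMatrix`. -/
noncomputable def chainToOrderShift (P : Type*) [PartialOrder P] : P → ℤ := fun x =>
  if IsChain (· ≤ ·) (Set.Iio x) then 1 else 0

theorem det_chainToOrderMatrix (P : Type*) [PartialOrder P] [Fintype P] [DecidableEq P] :
    (chainToOrderMatrix P).det = 1 ∨ (chainToOrderMatrix P).det = -1 := by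
  classical
  -- The elements with a chain below form a lower set, so a nonzero entry never mixes the two kinds
  -- of columns. Entries of the first kind go down in the order and the others go up, hence the sign
  -- change: off the diagonal, a nonzero entry strictly increases `b` from row to column.
  let b : P → ℤ := fun x =>
    if IsChain (· ≤ ·) (Set.Iio x) then (Finset.univ.filter (· ≤ x)).card
    else -((Finset.univ.filter (· ≤ x)).card : ℤ)
  have hmono : ∀ x y : P, x < y →
      (Finset.univ.filter (· ≤ x)).card < (Finset.univ.filter (· ≤ y)).card := by
    intro x y hxy
    refine Finset.card_lt_card (Finset.ssubset_iff_subset_ne.2 ⟨fun z hz => ?_, fun h => ?_⟩)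
    · simp only [Finset.mem_filter, Finset.mem_univ, true_and] at hz ⊢
      exact hz.trans hxy.le
    · have : y ∈ Finset.univ.filter (· ≤ x) := by rw [h]; simp
      simp only [Finset.mem_filter, Finset.mem_univ, true_and] at this
      exact hxy.not_ge this
  have key : ∀ y x : P, chainToOrderMatrix P y x ≠ 0 → y = x ∨ b y < b x := by
    intro y x hne
    unfold chainToOrderMatrix at hne
    by_cases hx : IsChain (· ≤ ·) (Set.Iio x)
    · have hyx : y ≤ x := by by_contra h; simp [hx, h] at hne
      rcases hyx.eq_or_lt with h | h
      · exact Or.inl h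
      · have hy : IsChain (· ≤ ·) (Set.Iio y) := hx.mono (Set.Iio_subset_Iio hyx)
        right
        simpa [b, hx, hy] using hmono y x h
    · have hyx : x ≤ y := by by_contra h; simp [hx, h] at hne
      rcases hyx.eq_or_lt with h | h
      · exact Or.inl h.symm
      · have hy : ¬ IsChain (· ≤ ·) (Set.Iio y) := fun hc =>
          hx (hc.mono (Set.Iio_subset_Iio hyx))
        right
        simpa [b, hx, hy] using hmono x y h
  have htri : (chainToOrderMatrix P).BlockTriangular b := by
    intro y x hlt
    by_contra hne
    rcases key y x hne with h | h
    · subst h; exact lt_irrefl _ hlt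
    · exact lt_asymm h hlt
  rw [← Int.isUnit_iff, htri.det]
  refine IsUnit.prod_iff.2 fun k _ => ?_
  have hdiag : (chainToOrderMatrix P).toSquareBlock b k =
      Matrix.diagonal fun x => chainToOrderMatrix P x.1 x.1 := by
    ext y x
    by_cases h : y = x
    · subst h; simp [Matrix.toSquareBlock_def]
    · rw [Matrix.diagonal_apply_ne _ h]
      by_contra hne
      rcases key y.1 x.1 hne with h' | h'
      · exact h (Subtype.ext h')
      · rw [y.2, x.2] at h'; exact lt_irrefl _ h'
  rw [hdiag, Matrix.det_diagonal]
  refine IsUnit.prod_iff.2 fun x _ => ?_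
  unfold chainToOrderMatrix
  split_ifs <;> simp_all

/-- Call an element lower if the elements below it form a chain. Each coordinate of `y` is a
difference of values of `a` along a cover (or `1 - a x` at a minimal element, `a x` at a maximal one
that is not lower). The sum over a maximal chain is controlled by the single step at which the chain
leaves the lower elements. -/
theorem mem_chainPolytope_iff_mem_orderPolytope [Fintype P]
    (hP : ∀ x : P, IsChain (· ≤ ·) (Set.Iio x) ∨ IsChain (· ≤ ·) (Set.Ioi x)) (y : P → ℝ) :
    y ∈ chainPolytope P ↔
      Matrix.vecMul y ((chainToOrderMatrix P).map (fun z : ℤ => (z : ℝ))) +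
        (fun i => (chainToOrderShift P i : ℝ)) ∈ orderPolytope P := by
  classical
  set a : P → ℝ := Matrix.vecMul y ((chainToOrderMatrix P).map (fun z : ℤ => (z : ℝ))) +
        (fun i => (chainToOrderShift P i : ℝ)) with ha
  have haL : ∀ x, IsChain (· ≤ ·) (Set.Iio x) →
      a x = 1 - ∑ z ∈ Finset.univ.filter (· ≤ x), y z := by
    intro x hx
    simp [ha, Matrix.vecMul, dotProduct, chainToOrderMatrix, chainToOrderShift, hx,
      Finset.sum_filter, apply_ite]
    rw [← sub_eq_zero]
    have : ∀ z, (if z ≤ x then -y z else 0) = -(if z ≤ x then y z else 0) := by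
      intro z; split_ifs <;> simp
    simp only [this, Finset.sum_neg_distrib]
    ring
  have haU : ∀ x, ¬ IsChain (· ≤ ·) (Set.Iio x) →
      a x = ∑ z ∈ Finset.univ.filter (x ≤ ·), y z := by
    intro x hx
    simp [ha, Matrix.vecMul, dotProduct, chainToOrderMatrix, chainToOrderShift, hx,
      Finset.sum_filter]
  have hdown : ∀ x : P, IsChain (· ≤ ·) (Set.Iio x) →
      IsChain (· ≤ ·) ((Finset.univ.filter (· ≤ x) : Finset P) : Set P) := by
    intro x hx
    simpa [Set.Iic_def] using isChain_Iic_of_isChain_Iio hx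
  have hup : ∀ x : P, ¬ IsChain (· ≤ ·) (Set.Iio x) →
      IsChain (· ≤ ·) ((Finset.univ.filter (x ≤ ·) : Finset P) : Set P) := by
    intro x hx
    simpa [Set.Ici_def] using isChain_Ici_of_isChain_Ioi ((hP x).resolve_left hx)
  constructor
  · intro hy
    have hnn : ∀ s : Finset P, 0 ≤ ∑ z ∈ s, y z := fun s => Finset.sum_nonneg fun z _ => hy.1 z
    refine ⟨fun x => ?_, fun x x' hxx' => ?_⟩
    · by_cases hx : IsChain (· ≤ ·) (Set.Iio x)
      · rw [haL x hx]
        have h1 := sum_le_one_of_mem_chainPolytope hy (hdown x hx)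
        have h2 := hnn (Finset.univ.filter (· ≤ x))
        constructor <;> linarith
      · rw [haU x hx]
        exact ⟨hnn _, sum_le_one_of_mem_chainPolytope hy (hup x hx)⟩
    · by_cases hx' : IsChain (· ≤ ·) (Set.Iio x')
      · have hx : IsChain (· ≤ ·) (Set.Iio x) := hx'.mono (Set.Iio_subset_Iio hxx')
        rw [haL x hx, haL x' hx']
        have := Finset.sum_le_sum_of_subset_of_nonneg (f := y)
          (s := Finset.univ.filter (· ≤ x)) (t := Finset.univ.filter (· ≤ x'))
          (fun z hz => by simp at hz ⊢; exact hz.trans hxx') fun z _ _ => hy.1 z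
        linarith
      · by_cases hx : IsChain (· ≤ ·) (Set.Iio x)
        · rw [haL x hx, haU x' hx']
          -- Everything below `x` together with everything above `x'` is one chain, so the sum over
          -- it is at most 1, which is `a x' ≤ a x`.
          have hdisj : Disjoint (Finset.univ.filter (· ≤ x)) (Finset.univ.filter (x' ≤ ·)) := by
            refine Finset.disjoint_filter.2 fun z _ h1 h2 => hx' ?_
            have : x = x' := le_antisymm hxx' (h2.trans h1)
            rwa [← this]
          have hch : IsChain (· ≤ ·) ((Finset.univ.filter (· ≤ x) ∪
              Finset.univ.filter (x' ≤ ·) : Finset P) : Set P) := by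
            rw [Finset.coe_union, isChain_union]
            refine ⟨hdown x hx, hup x' hx', fun p hp q hq _ => Or.inl ?_⟩
            simp at hp hq
            exact hp.trans (hxx'.trans hq)
          have := sum_le_one_of_mem_chainPolytope hy hch
          rw [Finset.sum_union hdisj] at this
          linarith
        · rw [haU x hx, haU x' hx']
          exact Finset.sum_le_sum_of_subset_of_nonneg
            (fun z hz => by simp at hz ⊢; exact hxx'.trans hz) fun z _ _ => hy.1 z
  · intro hO
    have hnn : ∀ x, 0 ≤ y x := by
      intro x
      by_cases hx : IsChain (· ≤ ·) (Set.Iio x)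
      · have e : a x = 1 - (y x + ∑ z ∈ Finset.univ.filter (· < x), y z) := by
          rw [haL x hx]
          congr 1
          rw [← Finset.sum_insert (by simp)]
          refine Finset.sum_congr ?_ fun _ _ => rfl
          ext z; simp [le_iff_eq_or_lt]
        by_cases hmin : IsMin x
        · have : Finset.univ.filter (· < x) = ∅ := by
            ext z; simpa using hmin.not_lt
          rw [this, Finset.sum_empty] at e
          linarith [(hO.1 x).2]
        -- Since the elements below `x` form a chain, `m` is the only lower cover of `x`, and `y x =
        -- a m - a x`.
        · obtain ⟨m, hm⟩ := exists_covBy_of_wellFoundedGT hmin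
          have hmx : IsChain (· ≤ ·) (Set.Iio m) := hx.mono (Set.Iio_subset_Iio hm.le)
          have : Finset.univ.filter (· < x) = Finset.univ.filter (· ≤ m) := by
            ext z
            simp only [Finset.mem_filter, Finset.mem_univ, true_and]
            refine ⟨fun hz => ?_, fun hz => hz.trans_lt hm.lt⟩
            rcases hx.total (x := z) (y := m) hz hm.lt with h | h
            · exact h
            · rcases h.eq_or_lt with h | h
              · exact h.ge
              · exact absurd hz (hm.2 h)
          rw [this] at e
          have := haL m hmx
          have := hO.2 m x hm.le
          linarith
      · have hxu := (hP x).resolve_left hx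
        have e : a x = y x + ∑ z ∈ Finset.univ.filter (x < ·), y z := by
          rw [haU x hx, ← Finset.sum_insert (by simp)]
          refine Finset.sum_congr ?_ fun _ _ => rfl
          ext z; simp [le_iff_eq_or_lt, eq_comm]
        by_cases hmax : IsMax x
        · have : Finset.univ.filter (x < ·) = ∅ := by
            ext z; simpa using hmax.not_lt
          rw [this, Finset.sum_empty] at e
          linarith [(hO.1 x).1]
        -- Dually, `m` is the only upper cover of `x`, it is not lower either, and `y x = a x - a
        -- m`.
        · obtain ⟨m, hm⟩ := exists_covBy_of_wellFoundedLT hmax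
          have hmx : ¬ IsChain (· ≤ ·) (Set.Iio m) := fun hc =>
            hx (hc.mono (Set.Iio_subset_Iio hm.le))
          have : Finset.univ.filter (x < ·) = Finset.univ.filter (m ≤ ·) := by
            ext z
            simp only [Finset.mem_filter, Finset.mem_univ, true_and]
            refine ⟨fun hz => ?_, fun hz => hm.lt.trans_le hz⟩
            rcases hxu.total (x := z) (y := m) hz hm.lt with h | h
            · rcases h.eq_or_lt with h | h
              · exact h.ge
              · exact absurd h (hm.2 hz)
            · exact h
          rw [this] at e
          have := haU m hmx
          have := hO.2 x m hm.le
          linarith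
    refine ⟨fun x => hnn x, fun s hs => ?_⟩
    -- With `p` the top of the lower part of the chain and `q` the bottom of the rest, the two
    -- partial sums are at most `1 - a p` and `a q`, and `a q ≤ a p` because `p ≤ q`.
    set L := s.filter fun x => IsChain (· ≤ ·) (Set.Iio x)
    set U := s.filter fun x => ¬ IsChain (· ≤ ·) (Set.Iio x)
    have hsum : ∑ i ∈ L, y i + ∑ i ∈ U, y i = ∑ i ∈ s, y i :=
      Finset.sum_filter_add_sum_filter_not s _ _
    have hL : L = ∅ ∨ ∃ p ∈ L, ∑ i ∈ L, y i ≤ 1 - a p := by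
      rcases L.eq_empty_or_nonempty with h | h
      · exact Or.inl h
      · obtain ⟨p, hp⟩ := L.exists_maximal h
        have hp' := Finset.mem_filter.1 hp.1
        refine Or.inr ⟨p, hp.1, ?_⟩
        rw [haL p hp'.2, sub_sub_cancel]
        refine Finset.sum_le_sum_of_subset_of_nonneg (fun z hz => ?_) fun z _ _ => hnn z
        have hz' := Finset.mem_filter.1 hz
        simp only [Finset.mem_filter, Finset.mem_univ, true_and]
        rcases hs.1.total hz'.1 hp'.1 with h | h
        · exact h
        · exact hp.2 hz h
    have hU : U = ∅ ∨ ∃ q ∈ U, ∑ i ∈ U, y i ≤ a q := by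
      rcases U.eq_empty_or_nonempty with h | h
      · exact Or.inl h
      · obtain ⟨p, hp⟩ := U.exists_minimal h
        have hp' := Finset.mem_filter.1 hp.1
        refine Or.inr ⟨p, hp.1, ?_⟩
        rw [haU p hp'.2]
        refine Finset.sum_le_sum_of_subset_of_nonneg (fun z hz => ?_) fun z _ _ => hnn z
        have hz' := Finset.mem_filter.1 hz
        simp only [Finset.mem_filter, Finset.mem_univ, true_and]
        rcases hs.1.total hz'.1 hp'.1 with h | h
        · exact hp.2 hz h
        · exact h
    rw [← hsum]
    rcases hL with hL | ⟨p, hp, hpL⟩ <;> rcases hU with hU | ⟨q, hq, hqU⟩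
    · simp [hL, hU]
    · rw [hL, Finset.sum_empty, zero_add]
      exact hqU.trans (hO.1 q).2
    · rw [hU, Finset.sum_empty, add_zero]
      linarith [(hO.1 p).1]
    · have hp' := Finset.mem_filter.1 hp
      have hq' := Finset.mem_filter.1 hq
      have hpq : p ≤ q := by
        rcases hs.1.total hp'.1 hq'.1 with h | h
        · exact h
        · exact absurd (hp'.2.mono (Set.Iio_subset_Iio h)) hq'.2
      have := hO.2 p q hpq
      linarith

theorem unimodularlyEquivalent_of_not_posetX [Fintype P] [DecidableEq P]
    (h : ¬ Nonempty (PosetX ↪o P)) :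
    UnimodularlyEquivalent (orderPolytope P) (chainPolytope P) := by
  refine unimodularlyEquivalent_of_mem_iff (chainToOrderMatrix P) (chainToOrderShift P)
    (det_chainToOrderMatrix P) (mem_chainPolytope_iff_mem_orderPolytope fun x => ?_)
  by_contra! hx
  exact h (nonempty_posetX_orderEmbedding_iff.2 ⟨x, hx⟩)

end Unimodular

/-! ### Facets of a polyhedron given by inequalities -/

section PolyhedronFacets

variable {ι J : Type*}

theorem exists_pos_forall_le_of_forall_lt [Finite J] (l : J → ((ι → ℝ) →ₗ[ℝ] ℝ)) (c : J → ℝ) (p v : ι → ℝ)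
    (h : ∀ j, l j p < c j ∨ l j p = c j ∧ l j v ≤ 0) :
    ∃ t : ℝ, 0 < t ∧ ∀ j, l j (p + t • v) ≤ c j := by
  have key : ∀ j, ∀ᶠ t : ℝ in nhdsWithin 0 (Set.Ioi 0), l j (p + t • v) ≤ c j := by
    intro j
    rcases h j with h | h
    · have hc : Filter.Tendsto (fun t : ℝ => l j p + t * l j v)
          (nhdsWithin 0 (Set.Ioi 0)) (nhds (l j p)) := by
        have : Continuous fun t : ℝ => l j p + t * l j v := by fun_prop
        have h3 := (this.tendsto 0).mono_left (nhdsWithin_le_nhds (s := Set.Ioi 0))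
        simpa using h3
      filter_upwards [hc.eventually (gt_mem_nhds h)] with t ht
      simpa using ht.le
    · filter_upwards [self_mem_nhdsWithin] with t ht
      have ht : (0 : ℝ) < t := ht
      simpa [h.1] using mul_nonpos_of_nonneg_of_nonpos ht.le h.2
  obtain ⟨t, htK, ht⟩ := ((Filter.eventually_all.2 key).and self_mem_nhdsWithin).exists
  exact ⟨t, ht, htK⟩

theorem convex_setOf_forall_le (l : J → ((ι → ℝ) →ₗ[ℝ] ℝ)) (c : J → ℝ) :
    Convex ℝ {x : ι → ℝ | ∀ j, l j x ≤ c j} := by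
  rw [Set.ofPred_forall]
  exact convex_iInter fun j => convex_halfSpace_le (l j).isLinear (c j)

theorem linearMap_eq_of_vectorSpan_le {K F : Set (ι → ℝ)} (f : (ι → ℝ) →ₗ[ℝ] ℝ)
    (hf : ∀ x ∈ F, ∀ y ∈ F, f x = f y) (h : vectorSpan ℝ K ≤ vectorSpan ℝ F) :
    ∀ x ∈ K, ∀ y ∈ K, f x = f y := by
  have h1 : vectorSpan ℝ F ≤ LinearMap.ker f := by
    refine Submodule.span_le.2 ?_
    rintro _ ⟨x, hx, y, hy, rfl⟩
    simp [hf x hx y hy]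
  intro x hx y hy
  have h2 := h1 (h (vsub_mem_vectorSpan ℝ hx hy))
  simpa [sub_eq_zero] using h2

/-- Every facet of a polyhedron is cut out by one of its defining inequalities. -/
theorem exists_facet_eq [Finite ι] [Fintype J] (l : J → ((ι → ℝ) →ₗ[ℝ] ℝ)) (c : J → ℝ) {F : Set (ι → ℝ)}
    (hF : IsPolytopeFace {x : ι → ℝ | ∀ j, l j x ≤ c j} F)
    (hd : polytopeDim F + 1 = polytopeDim {x : ι → ℝ | ∀ j, l j x ≤ c j}) :
    ∃ j, F = {x | (∀ i, l i x ≤ c i) ∧ l j x = c j} := by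
  classical
  set K : Set (ι → ℝ) := {x | ∀ j, l j x ≤ c j} with hK
  obtain ⟨⟨z, hz⟩, f, hf⟩ := isPolytopeFace_iff_exists_linearMap.1 hF
  have hFK : F ⊆ K := fun x hx => by rw [hf] at hx; exact hx.1
  have hFc : Convex ℝ F := hF.2.convex (convex_setOf_forall_le l c)
  have hfF : ∀ x ∈ F, ∀ y ∈ F, f x = f y := by
    intro x hx y hy
    rw [hf] at hx hy
    exact le_antisymm (hy.2 x hx.1) (hx.2 y hy.1)
  have hspan : ∀ S T : Set (ι → ℝ), S ⊆ T → vectorSpan ℝ S ≤ vectorSpan ℝ T := fun S T h =>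
    vectorSpan_mono ℝ h
  -- Some inequality is tight on all of `F` but not on all of `K`. Otherwise `F` would contain a
  -- point relatively interior to `K`, which forces `F = K`.
  have key : ∃ j, (∀ x ∈ F, l j x = c j) ∧ ∃ y ∈ K, l j y < c j := by
    by_contra! hcon
    have hp : ∀ j, ∃ p ∈ F, (∀ x ∈ F, l j x = c j) ∨ l j p < c j := by
      intro j
      by_cases h : ∀ x ∈ F, l j x = c j
      · exact ⟨z, hz, Or.inl h⟩
      · push Not at h
        obtain ⟨p, hp, hne⟩ := h
        exact ⟨p, hp, Or.inr (lt_of_le_of_ne (hFK hp j) hne)⟩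
    choose p hpF hp using hp
    -- The average of the points `p j` is strict in every inequality in which some point of `F` is.
    obtain ⟨q, hqF, hq⟩ : ∃ q ∈ F, ∀ j, (∀ x ∈ F, l j x = c j) ∨ l j q < c j := by
      rcases isEmpty_or_nonempty J with hJ | hJ
      · exact ⟨z, hz, fun j => isEmptyElim j⟩
      have hcard : (0 : ℝ) < Fintype.card J := by exact_mod_cast Fintype.card_pos
      have hw : ∑ _j : J, ((Fintype.card J : ℝ)⁻¹) = 1 := by
        rw [Finset.sum_const, Finset.card_univ, nsmul_eq_mul, mul_inv_cancel₀ hcard.ne']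
      refine ⟨∑ j, (Fintype.card J : ℝ)⁻¹ • p j,
        hFc.sum_mem (fun _ _ => by positivity) hw fun j _ => hpF j, fun j => ?_⟩
      refine (hp j).imp_right fun hj => ?_
      have h1 : l j (∑ i, (Fintype.card J : ℝ)⁻¹ • p i) =
          ∑ i, (Fintype.card J : ℝ)⁻¹ * l j (p i) := by simp [map_sum]
      have h2 : c j = ∑ _i : J, (Fintype.card J : ℝ)⁻¹ * c j := by
        rw [← Finset.sum_mul, hw, one_mul]
      rw [h1, h2]
      refine Finset.sum_lt_sum (fun i _ => ?_) ⟨j, Finset.mem_univ j, ?_⟩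
      · exact mul_le_mul_of_nonneg_left (hFK (hpF i) j) (by positivity)
      · exact mul_lt_mul_of_pos_left hj (by positivity)
    have hKF : K ⊆ F := by
      intro y hy
      -- From `q` one can move a little away from any `y ∈ K` and stay in `K`. As `f` is maximal at
      -- `q`, this gives `f q ≤ f y`, so `y ∈ F`.
      obtain ⟨t, ht, htK⟩ := exists_pos_forall_le_of_forall_lt l c q (q - y) fun j => by
        rcases hq j with h | h
        · right
          refine ⟨h q hqF, ?_⟩
          have := hcon j h y hy
          rw [map_sub, h q hqF]
          linarith
        · exact Or.inl h
      have hq' : q ∈ {x | x ∈ K ∧ ∀ y ∈ K, f y ≤ f x} := hf ▸ hqF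
      have h1 := hq'.2 _ htK
      rw [map_add, map_smul, map_sub, smul_eq_mul] at h1
      have h2 : f q ≤ f y := by
        by_contra! h
        have := mul_pos ht (sub_pos.2 h)
        linarith
      rw [hf]
      exact ⟨hy, fun x hx => (hq'.2 x hx).trans h2⟩
    rw [Set.Subset.antisymm hFK hKF] at hd
    omega
  obtain ⟨j, hj, y, hy, hyj⟩ := key
  refine ⟨j, ?_⟩
  set G : Set (ι → ℝ) := {x | (∀ i, l i x ≤ c i) ∧ l j x = c j} with hG
  have hFG : F ⊆ G := fun x hx => ⟨hFK hx, hj x hx⟩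
  have hGK : G ⊆ K := fun x hx => hx.1
  have hlt : polytopeDim G < polytopeDim K := by
    refine lt_of_le_of_ne (Submodule.finrank_mono (hspan G K hGK)) fun heq => ?_
    have h1 := Submodule.eq_of_le_of_finrank_eq (hspan G K hGK) heq
    have h2 := linearMap_eq_of_vectorSpan_le (l j) (fun x hx y hy => hx.2.trans hy.2.symm) h1.ge
      y hy z (hFK hz)
    rw [hj z hz] at h2
    exact hyj.ne h2
  have hle : polytopeDim F ≤ polytopeDim G := Submodule.finrank_mono (hspan F G hFG)
  -- `F ⊆ G ⊆ K` with `dim G < dim K = dim F + 1`, so `F` and `G` have the same direction space.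
  -- Hence `f` is constant on `G`, at its maximal value.
  have hspanFG := Submodule.eq_of_le_of_finrank_eq (hspan F G hFG)
    (show polytopeDim F = polytopeDim G by omega)
  refine Set.Subset.antisymm hFG fun x hx => ?_
  have h1 := linearMap_eq_of_vectorSpan_le f hfF hspanFG.ge x hx z (hFG hz)
  rw [hf] at hz ⊢
  exact ⟨hGK hx, fun y hy => h1 ▸ hz.2 y hy⟩

/-- The facets of a polyhedron are among the sets cut out by its defining inequalities. -/
theorem facets_subset_range [Finite ι] [Fintype J] (l : J → ((ι → ℝ) →ₗ[ℝ] ℝ)) (c : J → ℝ) :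
    {F : Set (ι → ℝ) | IsPolytopeFace {x : ι → ℝ | ∀ j, l j x ≤ c j} F ∧
      polytopeDim F + 1 = polytopeDim {x : ι → ℝ | ∀ j, l j x ≤ c j}} ⊆
      Set.range fun j => {x | (∀ i, l i x ≤ c i) ∧ l j x = c j} := by
  rintro F ⟨hF, hd⟩
  obtain ⟨j, hj⟩ := exists_facet_eq l c hF hd
  exact ⟨j, hj.symm⟩

theorem facetNumber_le_card [Finite ι] [Fintype J] (l : J → ((ι → ℝ) →ₗ[ℝ] ℝ)) (c : J → ℝ) :
    facetNumber {x : ι → ℝ | ∀ j, l j x ≤ c j} ≤ Fintype.card J := by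
  refine (Set.ncard_le_ncard (facets_subset_range l c) (Set.toFinite _)).trans ?_
  rw [← Set.image_univ]
  refine (Set.ncard_image_le Set.finite_univ).trans ?_
  rw [Set.ncard_univ, Nat.card_eq_fintype_card]

/-- An inequality that some point satisfies with equality, and all others strictly, defines a
facet. -/
theorem polytopeDim_add_one_of_irredundant [Finite ι] [Fintype J] (l : J → ((ι → ℝ) →ₗ[ℝ] ℝ)) (c : J → ℝ) (j : J)
    (hj : l j ≠ 0) (p : ι → ℝ) (hpj : l j p = c j) (hp : ∀ i, i ≠ j → l i p < c i) :
    polytopeDim {x | (∀ i, l i x ≤ c i) ∧ l j x = c j} + 1 =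
      polytopeDim {x : ι → ℝ | ∀ i, l i x ≤ c i} := by
  classical
  have hpK : ∀ i, l i p ≤ c i := fun i => by
    by_cases h : i = j
    · exact h ▸ hpj.le
    · exact (hp i h).le
  -- Only inequality `j` is tight at `p`, so every direction with `l j v ≤ 0` is feasible there.
  -- Hence `K` spans the whole space and the tight set spans `ker (l j)`.
  have hstep : ∀ v, l j v ≤ 0 → ∃ t : ℝ, 0 < t ∧ ∀ i, l i (p + t • v) ≤ c i := fun v hv =>
    exists_pos_forall_le_of_forall_lt l c p v fun i => by
      by_cases h : i = j
      · subst h; exact Or.inr ⟨hpj, hv⟩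
      · exact Or.inl (hp i h)
  have hsmul : ∀ (S : Submodule ℝ (ι → ℝ)) (t : ℝ) (v : ι → ℝ), 0 < t →
      (p + t • v) -ᵥ p ∈ S → v ∈ S := by
    intro S t v ht h
    rw [vsub_eq_sub, add_sub_cancel_left] at h
    exact (S.smul_mem_iff ht.ne').1 h
  have htop : vectorSpan ℝ {x : ι → ℝ | ∀ i, l i x ≤ c i} = ⊤ := by
    have hneg : ∀ v, l j v ≤ 0 → v ∈ vectorSpan ℝ {x : ι → ℝ | ∀ i, l i x ≤ c i} := by
      intro v hv
      obtain ⟨t, ht, htK⟩ := hstep v hv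
      exact hsmul _ t v ht (vsub_mem_vectorSpan ℝ htK hpK)
    refine eq_top_iff.2 fun v _ => ?_
    rcases le_total (l j v) 0 with h | h
    · exact hneg v h
    · exact (Submodule.neg_mem_iff _).1 (hneg (-v) (by rw [map_neg]; linarith))
  have hker : vectorSpan ℝ {x | (∀ i, l i x ≤ c i) ∧ l j x = c j} = LinearMap.ker (l j) := by
    refine le_antisymm ?_ fun v hv => ?_
    · refine Submodule.span_le.2 ?_
      rintro _ ⟨x, hx, y, hy, rfl⟩
      simp [hx.2, hy.2]
    · have hv : l j v = 0 := hv
      obtain ⟨t, ht, htK⟩ := hstep v hv.le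
      exact hsmul _ t v ht (vsub_mem_vectorSpan ℝ ⟨htK, by simp [hv, hpj]⟩ ⟨hpK, hpj⟩)
  rw [polytopeDim, polytopeDim, htop, hker, finrank_top]
  exact Module.Dual.finrank_ker_add_one_of_ne_zero hj

theorem facetNumber_eq_card_of_irredundant [Finite ι] [Fintype J] (l : J → ((ι → ℝ) →ₗ[ℝ] ℝ)) (c : J → ℝ)
    (hl : ∀ j, l j ≠ 0) (hp : ∀ j, ∃ p : ι → ℝ, l j p = c j ∧ ∀ i, i ≠ j → l i p < c i) :
    facetNumber {x : ι → ℝ | ∀ j, l j x ≤ c j} = Fintype.card J := by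
  refine le_antisymm (facetNumber_le_card l c) ?_
  choose p hpj hp using hp
  set G : J → Set (ι → ℝ) := fun j => {x | (∀ i, l i x ≤ c i) ∧ l j x = c j} with hG
  have hpG : ∀ j, p j ∈ G j := fun j => by
    refine ⟨fun i => ?_, hpj j⟩
    by_cases h : i = j
    · exact h ▸ (hpj j).le
    · exact (hp j i h).le
  have hinj : Function.Injective G := by
    intro i j hij
    by_contra hne
    have h1 : p j ∈ G i := hij ▸ hpG j
    exact (hp j i hne).ne h1.2
  have hsub : Set.range G ⊆ {F : Set (ι → ℝ) | IsPolytopeFace {x : ι → ℝ | ∀ j, l j x ≤ c j} F ∧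
      polytopeDim F + 1 = polytopeDim {x : ι → ℝ | ∀ j, l j x ≤ c j}} := by
    rintro _ ⟨j, rfl⟩
    refine ⟨isPolytopeFace_of_linearMap_le ⟨p j, hpG j⟩ (l j) (c j) (fun x hx => hx j)
      fun x => Iff.rfl, ?_⟩
    exact polytopeDim_add_one_of_irredundant l c j (hl j) (p j) (hpj j) (hp j)
  have h := Set.ncard_le_ncard hsub ((Set.toFinite _).subset (facets_subset_range l c))
  rwa [← Set.image_univ, Set.ncard_image_of_injective _ hinj, Set.ncard_univ,
    Nat.card_eq_fintype_card] at h

end PolyhedronFacets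

/-! ### Counting maximal chains by their last non-greedy step -/

section MaximalChains

variable {P : Type*} [PartialOrder P]

/-- Starting from a chain with top `y`, append `s y`, `s (s y)`, … up to a maximal element, then
extend to a maximal chain. The appended steps are covers, so the extension inserts nothing among
them. -/
theorem exists_isMaxChain_greedy [Finite P] {s : P → P} (hs : ∀ x, ¬ IsMax x → x ⋖ s x) (y : P) :
    ∀ L : Set P, IsChain (· ≤ ·) L → y ∈ L → (∀ z ∈ L, z ≤ y) →
      ∃ T : Finset P, IsMaxChain (· ≤ ·) (T : Set P) ∧ L ⊆ T ∧
        ∀ z ∈ T, y ≤ z → ¬ IsMax z → s z ∈ T := by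
  induction y using WellFoundedGT.induction with
  | ind y ih =>
    intro L hL hyL hLy
    by_cases hy : IsMax y
    · obtain ⟨M, hM, hLM⟩ := hL.exists_maxChain
      refine ⟨(Set.toFinite M).toFinset, by simpa using hM, by simpa using hLM, ?_⟩
      intro z _ hyz hz
      exact absurd (hy.eq_of_le hyz ▸ hy) hz
    · have hcov := hs y hy
      have hle : ∀ z ∈ L, z ≤ s y := fun z hz => (hLy z hz).trans hcov.le
      obtain ⟨T, hT, hLT, hTs⟩ := ih (s y) hcov.lt (insert (s y) L)
        (hL.insert fun z hz _ => Or.inr (hle z hz)) (Set.mem_insert _ _) (by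
          rintro z (rfl | hz)
          · exact le_rfl
          · exact hle z hz)
      refine ⟨T, hT, (Set.subset_insert _ _).trans hLT, fun z hz hyz hzm => ?_⟩
      have hsT : s y ∈ T := hLT (Set.mem_insert _ _)
      rcases hT.1.total hz hsT with h | h
      · rcases hyz.eq_or_lt with rfl | hlt
        · exact hsT
        · rcases h.eq_or_lt with h | h
          · exact hTs z hz h.ge hzm
          · exact absurd h (hcov.2 hlt)
      · exact hTs z hz h hzm

theorem IsChain.eq_of_covBy_of_covBy {T : Set P} (hT : IsChain (· ≤ ·) T) {x y z : P}
    (hy : y ∈ T) (hz : z ∈ T) (hxy : x ⋖ y) (hxz : x ⋖ z) : y = z := by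
  rcases hT.total hy hz with h | h
  · exact h.eq_of_not_lt fun h' => hxz.2 hxy.lt h'
  · exact (h.eq_of_not_lt fun h' => hxy.2 hxz.lt h').symm

/-- `x ⋖ y` is the last step of `T` that disagrees with the choice `s` of upper covers. -/
structure IsLastDeviation (s : P → P) (T : Finset P) (x y : P) : Prop where
  left_mem : x ∈ T
  right_mem : y ∈ T
  covBy : x ⋖ y
  ne : y ≠ s x
  greedy : ∀ z ∈ T, y ≤ z → ¬ IsMax z → s z ∈ T

/-- If `x < x'`, then `x'` lies at or above `y`, where the chain follows `s`. It would contain both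
`s x'` and `y'`, two distinct upper covers of `x'`. -/
theorem IsLastDeviation.not_lt {s : P → P} (hs : ∀ x, ¬ IsMax x → x ⋖ s x) {T : Finset P}
    (hT : IsChain (· ≤ ·) (T : Set P)) {x y x' y' : P} (h : IsLastDeviation s T x y)
    (h' : IsLastDeviation s T x' y') : ¬ x < x' := by
  intro hlt
  have hle : y ≤ x' := by
    rcases hT.total h.right_mem h'.left_mem with h1 | h1
    · exact h1
    · rcases h1.eq_or_lt with h2 | h2
      · exact h2.ge
      · exact absurd h2 (h.covBy.2 hlt)
  have hmax : ¬ IsMax x' := h'.covBy.lt.not_isMax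
  exact h'.ne (hT.eq_of_covBy_of_covBy h'.right_mem (h.greedy x' h'.left_mem hle hmax) h'.covBy
    (hs x' hmax))

theorem IsLastDeviation.unique {s : P → P} (hs : ∀ x, ¬ IsMax x → x ⋖ s x) {T : Finset P}
    (hT : IsChain (· ≤ ·) (T : Set P)) {x y x' y' : P} (h : IsLastDeviation s T x y)
    (h' : IsLastDeviation s T x' y') : x = x' ∧ y = y' := by
  have hx : x = x' := by
    rcases hT.total h.left_mem h'.left_mem with h1 | h1
    · exact h1.eq_of_not_lt (h.not_lt hs hT h')
    · exact (h1.eq_of_not_lt (h'.not_lt hs hT h)).symm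
  subst hx
  exact ⟨rfl, hT.eq_of_covBy_of_covBy h.right_mem h'.right_mem h.covBy h'.covBy⟩

/-- If `X` occurs in `P`, then the minimal elements, the maximal elements and the cover relations
are together fewer than the elements and the maximal chains. -/
theorem card_min_max_covBy_lt [Finite P] (hX : Nonempty (PosetX ↪o P)) :
    Nat.card ({x : P // IsMin x} ⊕ {x : P // IsMax x} ⊕ {p : P × P // p.1 ⋖ p.2}) <
      Nat.card (P ⊕ {T : Finset P // IsMaxChain (· ≤ ·) (T : Set P)}) := by
  classical
  have hex : ∀ x : P, ∃ y, ¬ IsMax x → x ⋖ y := fun x => by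
    by_cases h : IsMax x
    · exact ⟨x, fun h' => absurd h h'⟩
    · obtain ⟨y, hy⟩ := exists_covBy_of_wellFoundedLT h
      exact ⟨y, fun _ => hy⟩
  choose s hs using hex
  have hroot : ∀ m : {x : P // IsMin x}, ∃ T : {T : Finset P // IsMaxChain (· ≤ ·) (T : Set P)},
      m.1 ∈ T.1 ∧ ∀ z ∈ T.1, ¬ IsMax z → s z ∈ T.1 := by
    rintro ⟨m, hm⟩
    obtain ⟨T, hT, hmT, hg⟩ := exists_isMaxChain_greedy hs m {m} IsChain.singleton rfl (by simp)
    have hmT : m ∈ T := hmT rfl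
    refine ⟨⟨T, hT⟩, hmT, fun z hz => hg z hz ?_⟩
    rcases hT.1.total hmT hz with h | h
    · exact h
    · exact hm h
  -- The prescribed element `d ≤ x` leaves the part below `x` free; this freedom defeats
  -- surjectivity later.
  have hdev : ∀ x y : P, x ⋖ y → y ≠ s x → ∀ d ≤ x,
      ∃ T : {T : Finset P // IsMaxChain (· ≤ ·) (T : Set P)},
        d ∈ T.1 ∧ IsLastDeviation s T.1 x y := by
    intro x y hxy hne d hd
    obtain ⟨T, hT, hLT, hg⟩ := exists_isMaxChain_greedy hs y {d, x, y} (by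
      refine ((IsChain.singleton (a := y)).insert ?_).insert ?_
      · rintro b rfl _; exact Or.inl hxy.le
      · rintro b (rfl | rfl) _
        · exact Or.inl hd
        · exact Or.inl (hd.trans hxy.le)) (by simp) (by
      rintro z (rfl | rfl | rfl)
      · exact hd.trans hxy.le
      · exact hxy.le
      · exact le_rfl)
    exact ⟨⟨T, hT⟩, hLT (by simp), hLT (by simp), hLT (by simp), hxy, hne, hg⟩
  have hdev' : ∀ p : {p : P × P // p.1 ⋖ p.2},
      ∃ T : {T : Finset P // IsMaxChain (· ≤ ·) (T : Set P)},
        p.1.2 ≠ s p.1.1 → IsLastDeviation s T.1 p.1.1 p.1.2 := by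
    intro p
    by_cases h : p.1.2 = s p.1.1
    -- The value at a chosen cover is never used, so any maximal chain will do.
    · obtain ⟨M, hM, -⟩ := (IsChain.singleton (r := (· ≤ ·)) (a := p.1.1)).exists_maxChain
      exact ⟨⟨(Set.toFinite M).toFinset, by simpa using hM⟩, fun h' => absurd h h'⟩
    · obtain ⟨T, -, hT⟩ := hdev p.1.1 p.1.2 p.2 h p.1.1 le_rfl
      exact ⟨T, fun _ => hT⟩
  choose root hroot_mem hroot_greedy using hroot
  choose dev hdev' using hdev'
  have hnot : ∀ (m : {x : P // IsMin x}) (x y : P), ¬ IsLastDeviation s (root m).1 x y := by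
    intro m x y h
    have hmax : ¬ IsMax x := h.covBy.lt.not_isMax
    exact h.ne ((root m).2.1.eq_of_covBy_of_covBy h.right_mem
      (hroot_greedy m x h.left_mem hmax) h.covBy (hs x hmax))
  -- Maximal elements and chosen covers `x ⋖ s x` account for the elements of `P`. A minimal element
  -- goes to a chain that follows `s` throughout, any other cover to a chain of which it is the last
  -- deviation.
  let Φ : ({x : P // IsMin x} ⊕ {x : P // IsMax x} ⊕ {p : P × P // p.1 ⋖ p.2}) →
      (P ⊕ {T : Finset P // IsMaxChain (· ≤ ·) (T : Set P)}) :=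
    Sum.elim (fun m => Sum.inr (root m)) (Sum.elim (fun x => Sum.inl x.1)
      (fun p => if p.1.2 = s p.1.1 then Sum.inl p.1.1 else Sum.inr (dev p)))
  have hcov : ∀ p q : {p : P × P // p.1 ⋖ p.2}, p.1.1 = q.1.1 → p.1.2 = q.1.2 → p = q :=
    fun p q h1 h2 => Subtype.ext (Prod.ext h1 h2)
  have hinj : Function.Injective Φ := by
    rintro (m | x | p) (m' | x' | p') h
    · have h : root m = root m' := Sum.inr_injective h
      have h1 := hroot_mem m
      rw [h] at h1
      rcases (root m').2.1.total h1 (hroot_mem m') with h2 | h2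
      · exact congrArg _ (Subtype.ext (m'.2.eq_of_le h2))
      · exact congrArg _ (Subtype.ext (m.2.eq_of_le h2).symm)
    · simp [Φ] at h
    · by_cases hp : p'.1.2 = s p'.1.1
      · simp [Φ, hp] at h
      · simp only [Φ, Sum.elim_inl, Sum.elim_inr, hp, if_false, Sum.inr.injEq] at h
        exact absurd (h ▸ hdev' p' hp) (hnot m _ _)
    · simp [Φ] at h
    · simp only [Φ, Sum.elim_inl, Sum.elim_inr, Sum.inl.injEq] at h
      exact congrArg _ (congrArg _ (Subtype.ext h))
    · by_cases hp : p'.1.2 = s p'.1.1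
      · simp only [Φ, Sum.elim_inl, Sum.elim_inr, hp, if_true, Sum.inl.injEq] at h
        exact absurd (h ▸ x.2) p'.2.lt.not_isMax
      · simp [Φ, hp] at h
    · by_cases hp : p.1.2 = s p.1.1
      · simp [Φ, hp] at h
      · simp only [Φ, Sum.elim_inl, Sum.elim_inr, hp, if_false, Sum.inr.injEq] at h
        exact absurd (h ▸ hdev' p hp) (hnot m' _ _)
    · by_cases hp : p.1.2 = s p.1.1
      · simp only [Φ, Sum.elim_inl, Sum.elim_inr, hp, if_true, Sum.inl.injEq] at h
        exact absurd (h ▸ x'.2) p.2.lt.not_isMax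
      · simp [Φ, hp] at h
    · by_cases hp : p.1.2 = s p.1.1 <;> by_cases hp' : p'.1.2 = s p'.1.1
      · simp only [Φ, Sum.elim_inr, hp, hp', if_true, Sum.inl.injEq] at h
        rw [hcov p p' h (by rw [hp, hp', h])]
      · simp [Φ, hp, hp'] at h
      · simp [Φ, hp, hp'] at h
      · simp only [Φ, Sum.elim_inr, hp, hp', if_false, Sum.inr.injEq] at h
        have h1 := hdev' p hp
        rw [h] at h1
        obtain ⟨h2, h3⟩ := h1.unique hs (dev p').2.1 (hdev' p' hp')
        rw [hcov p p' h2 h3]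
  have hsurj : ¬ Function.Surjective Φ := by
    intro hsurj
    obtain ⟨a, hd, hu⟩ := nonempty_posetX_orderEmbedding_iff.1 hX
    -- Maximality of `x` among the elements with a non-chain above separates the covers `u` and `v`:
    -- a common one would still lie below both `b` and `c`. So at least one cover of `x` is not the
    -- chosen one.
    obtain ⟨x, hax, hx⟩ := Finite.exists_le_maximal
      (p := fun x : P => ¬ IsChain (· ≤ ·) (Set.Ioi x)) hu
    obtain ⟨b, hb, c, hc, hbc, hcb⟩ := not_isChain_iff_exists_incomparable.1 hx.prop
    obtain ⟨d, hda, e, hea, hde, hed⟩ := not_isChain_iff_exists_incomparable.1 hd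
    have hdx : d ≤ x := (le_of_lt hda).trans hax
    have hex : e ≤ x := (le_of_lt hea).trans hax
    obtain ⟨u, hxu, hub⟩ := exists_covBy_le_of_lt hb
    obtain ⟨v, hxv, hvc⟩ := exists_covBy_le_of_lt hc
    have huv : u ≠ v := by
      rintro rfl
      have hub' : u < b := hub.lt_of_ne (by rintro rfl; exact hbc hvc)
      have huc' : u < c := hvc.lt_of_ne (by rintro rfl; exact hcb hub)
      exact hxu.lt.not_ge (hx.le_of_ge (not_isChain_iff_exists_incomparable.2
        ⟨b, hub', c, huc', hbc, hcb⟩) hxu.le)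
    obtain ⟨y, hxy, hy⟩ : ∃ y, x ⋖ y ∧ y ≠ s x := by
      by_cases h : u = s x
      · exact ⟨v, hxv, fun h' => huv (h.trans h'.symm)⟩
      · exact ⟨u, hxu, h⟩
    have key : ∀ T : {T : Finset P // IsMaxChain (· ≤ ·) (T : Set P)},
        IsLastDeviation s T.1 x y → T = dev ⟨(x, y), hxy⟩ := by
      intro T hT
      obtain ⟨w, hw⟩ := hsurj (Sum.inr T)
      rcases w with m | z | p
      · have hw : root m = T := Sum.inr_injective hw
        exact absurd (hw ▸ hT) (hnot m x y)
      · simp [Φ] at hw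
      · by_cases hp : p.1.2 = s p.1.1
        · simp [Φ, hp] at hw
        · simp only [Φ, Sum.elim_inr, hp, if_false, Sum.inr.injEq] at hw
          have h1 := hdev' p hp
          rw [hw] at h1
          obtain ⟨h2, h3⟩ := h1.unique hs T.2.1 hT
          rw [← hw, hcov p ⟨(x, y), hxy⟩ h2 h3]
    -- Both chains have last deviation `x ⋖ y`, so surjectivity makes them equal; but one chain
    -- cannot contain both `d` and `e`.
    obtain ⟨T₁, hdT, hT₁⟩ := hdev x y hxy hy d hdx
    obtain ⟨T₂, heT, hT₂⟩ := hdev x y hxy hy e hex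
    have hT : T₁ = T₂ := (key T₁ hT₁).trans (key T₂ hT₂).symm
    subst hT
    rcases T₁.2.1.total hdT heT with h | h
    · exact hde h
    · exact hed h
  have := Fintype.ofFinite P
  rw [Nat.card_eq_fintype_card, Nat.card_eq_fintype_card]
  exact Fintype.card_lt_of_injective_not_surjective Φ hinj hsurj

end MaximalChains

/-! ### Facet counts of the two polytopes -/

section PosetFacets

variable {P : Type*} [PartialOrder P]

/-- In a finite poset, antitonicity need only be checked on covers. The value at `x` then lies
between those at a maximal element above and a minimal element below. -/
theorem orderPolytope_eq_setOf_forall_le [Finite P] :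
    orderPolytope P = {a : P → ℝ | ∀ j : {x : P // IsMin x} ⊕ {x : P // IsMax x} ⊕
        {p : P × P // p.1 ⋖ p.2},
      (Sum.elim (fun x => LinearMap.proj x.1) (Sum.elim (fun x => -LinearMap.proj x.1)
        (fun p => LinearMap.proj (R := ℝ) (φ := fun _ : P => ℝ) p.1.2 -
          LinearMap.proj (R := ℝ) (φ := fun _ : P => ℝ) p.1.1)) j : (P → ℝ) →ₗ[ℝ] ℝ) a ≤
      Sum.elim (fun _ => (1 : ℝ)) (fun _ => 0) j} := by
  classical
  have := Fintype.ofFinite P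
  let _ : LocallyFiniteOrder P := Fintype.toLocallyFiniteOrder
  ext a
  simp only [orderPolytope, Set.mem_ofPred_eq, Sum.forall, Sum.elim_inl, Sum.elim_inr,
    LinearMap.coe_proj, Function.eval, LinearMap.neg_apply, LinearMap.sub_apply, Subtype.forall,
    Prod.forall, sub_nonpos, neg_nonpos]
  constructor
  · rintro ⟨h1, h2⟩
    exact ⟨fun x _ => (h1 x).2, fun x _ => (h1 x).1, fun x y h => h2 x y h.le⟩
  · rintro ⟨hmin, hmax, hcov⟩
    have hanti : Antitone a := (antitone_iff_forall_covBy a).2 hcov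
    refine ⟨fun x => ⟨?_, ?_⟩, fun x y h => hanti h⟩
    · obtain ⟨y, hxy, hy⟩ := Finite.exists_le_maximal (p := fun _ : P => True) (a := x) trivial
      exact (hmax y fun z hz => hy.2 trivial hz).trans (hanti hxy)
    · obtain ⟨y, hyx, hy⟩ := Finite.exists_le_minimal (p := fun _ : P => True) (a := x) trivial
      exact (hanti hyx).trans (hmin y fun z hz => hy.2 trivial hz)

theorem facetNumber_orderPolytope_le [Finite P] :
    facetNumber (orderPolytope P) ≤
      Nat.card ({x : P // IsMin x} ⊕ {x : P // IsMax x} ⊕ {p : P × P // p.1 ⋖ p.2}) := by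
  classical
  have := Fintype.ofFinite P
  rw [orderPolytope_eq_setOf_forall_le, Nat.card_eq_fintype_card]
  exact facetNumber_le_card _ _

theorem chainPolytope_eq_setOf_forall_le :
    chainPolytope P = {a : P → ℝ | ∀ j : P ⊕ {T : Finset P // IsMaxChain (· ≤ ·) (T : Set P)},
      (Sum.elim (fun x => -LinearMap.proj x) (fun T => ∑ x ∈ T.1, LinearMap.proj x) j :
        (P → ℝ) →ₗ[ℝ] ℝ) a ≤ Sum.elim (fun _ => (0 : ℝ)) (fun _ => 1) j} := by
  ext a
  simp [chainPolytope]

/-- No defining inequality is redundant. For empty `P` the count fails: the empty chain is maximal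
but gives the zero functional. -/
theorem facetNumber_chainPolytope [Finite P] [Nonempty P] :
    facetNumber (chainPolytope P) =
      Nat.card (P ⊕ {T : Finset P // IsMaxChain (· ≤ ·) (T : Set P)}) := by
  classical
  have := Fintype.ofFinite P
  rw [chainPolytope_eq_setOf_forall_le, Nat.card_eq_fintype_card]
  have hN : (0 : ℝ) < Fintype.card P := by exact_mod_cast Fintype.card_pos
  have hne : ∀ T : Finset P, IsMaxChain (· ≤ ·) (T : Set P) → T.Nonempty := by
    intro T hT
    by_contra h
    rw [Finset.not_nonempty_iff_eq_empty] at h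
    subst h
    have x : P := Classical.arbitrary P
    have := hT.2 (t := {x}) IsChain.singleton (by simp)
    simp at this
  have hcard : ∀ T : Finset P, (T.card : ℝ) ≤ Fintype.card P := fun T => by
    exact_mod_cast Finset.card_le_univ T
  refine facetNumber_eq_card_of_irredundant _ _ ?_ ?_
  · rintro (x | T) h
    · have := LinearMap.congr_fun h (Pi.single x 1)
      simp at this
    · obtain ⟨x, hx⟩ := hne T.1 T.2
      have := LinearMap.congr_fun h (Pi.single x 1)
      simp [Pi.single_apply, hx] at this
  · rintro (x | ⟨T, hT⟩)
    · refine ⟨fun y => if y = x then 0 else ((Fintype.card P : ℝ) + 1)⁻¹, by simp, ?_⟩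
      rintro (y | ⟨T, hT⟩) hyx
      · have : y ≠ x := fun h => hyx (by rw [h])
        simp only [Sum.elim_inl, LinearMap.neg_apply, LinearMap.coe_proj, Function.eval, this,
          if_false, neg_lt_zero]
        positivity
      · simp only [Sum.elim_inr, LinearMap.sum_apply, LinearMap.coe_proj, Function.eval]
        calc ∑ y ∈ T, (if y = x then 0 else ((Fintype.card P : ℝ) + 1)⁻¹)
            ≤ ∑ _y ∈ T, ((Fintype.card P : ℝ) + 1)⁻¹ := by
              refine Finset.sum_le_sum fun y _ => ?_
              split_ifs
              · positivity
              · exact le_rfl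
          _ = T.card * ((Fintype.card P : ℝ) + 1)⁻¹ := by rw [Finset.sum_const, nsmul_eq_mul]
          _ < 1 := by
              rw [← div_eq_mul_inv, div_lt_one (by positivity)]
              linarith [hcard T]
    · have hTpos : (0 : ℝ) < T.card := by exact_mod_cast (hne T hT).card_pos
      -- Another maximal chain misses an element of `T`, losing at least `1 / |T|`. Its elements
      -- outside `T` contribute at most `|P| * ε < 1 / |T|`.
      set ε : ℝ := (T.card : ℝ)⁻¹ * ((Fintype.card P : ℝ) + 1)⁻¹ with hε
      have hεpos : 0 < ε := by positivity
      refine ⟨fun y => if y ∈ T then (T.card : ℝ)⁻¹ else ε, ?_, ?_⟩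
      · simp only [Sum.elim_inr, LinearMap.sum_apply, LinearMap.coe_proj, Function.eval]
        rw [Finset.sum_congr rfl fun y hy => if_pos hy, Finset.sum_const, nsmul_eq_mul,
          mul_inv_cancel₀ hTpos.ne']
      · rintro (y | ⟨S, hS⟩) hne'
        · simp only [Sum.elim_inl, LinearMap.neg_apply, LinearMap.coe_proj, Function.eval,
            neg_lt_zero]
          split_ifs <;> positivity
        · have hST : S ≠ T := fun h => hne' (by simp [h])
          have hnsub : ¬ T ⊆ S := fun h => hST
            (Finset.coe_injective (hT.2 hS.1 (Finset.coe_subset.2 h)).symm)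
          have hlt : (S ∩ T).card + 1 ≤ T.card := by
            refine Finset.card_lt_card (Finset.ssubset_iff_subset_ne.2
              ⟨Finset.inter_subset_right, fun h => hnsub ?_⟩)
            rw [← h]; exact Finset.inter_subset_left
          have hlt' : ((S ∩ T).card : ℝ) ≤ T.card - 1 := by
            have : ((S ∩ T).card : ℝ) + 1 ≤ T.card := by exact_mod_cast hlt
            linarith
          simp only [Sum.elim_inr, LinearMap.sum_apply, LinearMap.coe_proj, Function.eval]
          rw [Finset.sum_ite, Finset.sum_const, Finset.sum_const, nsmul_eq_mul, nsmul_eq_mul,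
            Finset.filter_mem_eq_inter]
          have h1 : ((S ∩ T).card : ℝ) * (T.card : ℝ)⁻¹ ≤ 1 - (T.card : ℝ)⁻¹ := by
            calc ((S ∩ T).card : ℝ) * (T.card : ℝ)⁻¹ ≤ (T.card - 1) * (T.card : ℝ)⁻¹ := by gcongr
              _ = 1 - (T.card : ℝ)⁻¹ := by rw [sub_mul, mul_inv_cancel₀ hTpos.ne', one_mul]
          have h2 : ((S.filter (· ∉ T)).card : ℝ) * ε < (T.card : ℝ)⁻¹ := by
            calc ((S.filter (· ∉ T)).card : ℝ) * ε ≤ Fintype.card P * ε := by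
                  gcongr; exact Finset.card_le_univ _
              _ < (Fintype.card P + 1) * ε := by nlinarith
              _ = (T.card : ℝ)⁻¹ := by
                  rw [hε, mul_left_comm, mul_inv_cancel₀ (by positivity), mul_one]
          linarith

theorem facetNumber_orderPolytope_lt_of_posetX [Finite P] (hX : Nonempty (PosetX ↪o P)) :
    facetNumber (orderPolytope P) < facetNumber (chainPolytope P) := by
  have : Nonempty P := hX.map fun f => f .a
  rw [facetNumber_chainPolytope]
  exact facetNumber_orderPolytope_le.trans_lt (card_min_max_covBy_lt hX)

end PosetFacets

/-! ### Vertex degrees in the two 1-skeletons -/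

section DegreeSequences

theorem mem_degreeSequence {V : Type*} [Finite V] {G : SimpleGraph V} {n : ℕ} :
    n ∈ degreeSequence G ↔ ∃ v, Nat.card (G.neighborSet v) = n := by
  classical
  let : Fintype V := Fintype.ofFinite V
  simp [degreeSequence, ← SimpleGraph.card_neighborSet_eq_degree, Nat.card_eq_fintype_card]

variable {P : Type*} [PartialOrder P]

theorem mem_chainPolytope_of_le {a b : P → ℝ} (ha : a ∈ chainPolytope P) (hb : ∀ x, 0 ≤ b x)
    (hba : ∀ x, b x ≤ a x) : b ∈ chainPolytope P :=
  ⟨hb, fun s hs => (Finset.sum_le_sum fun x _ => hba x).trans (ha.2 s hs)⟩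

theorem zero_mem_chainPolytope : (0 : P → ℝ) ∈ chainPolytope P :=
  ⟨fun _ => le_rfl, fun s _ => by simp⟩

theorem single_mem_chainPolytope [DecidableEq P] (x : P) :
    (Pi.single x 1 : P → ℝ) ∈ chainPolytope P := by
  refine ⟨fun y => ?_, fun s _ => ?_⟩
  · rcases eq_or_ne y x with rfl | h <;> simp [*]
  · simp only [Pi.single_apply, Finset.sum_ite_eq']
    split_ifs <;> norm_num

theorem zero_mem_polytopeVertices_chainPolytope [Finite P] :
    (0 : P → ℝ) ∈ polytopeVertices (chainPolytope P) := by
  have := Fintype.ofFinite P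
  refine isPolytopeFace_of_forall_linearMap_le (J := P) (Set.singleton_nonempty _)
    (fun x => -LinearMap.proj x) (fun _ => 0) (fun x a ha => by simpa using ha.1 x) fun a => ?_
  constructor
  · rintro rfl
    exact ⟨zero_mem_chainPolytope, fun x => by simp⟩
  · rintro ⟨-, h⟩
    ext x
    simpa using h x

/-- The neighbours of the origin in the 1-skeleton of a chain polytope are unit vectors. -/
theorem exists_eq_single_of_adj_zero [Finite P] [DecidableEq P]
    {w : P → ℝ} (hw : w ∈ polytopeVertices (chainPolytope P)) (h0 : w ≠ 0)
    (hface : IsPolytopeFace (chainPolytope P) (segment ℝ 0 w)) : ∃ x, w = Pi.single x 1 := by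
  have hwC : w ∈ chainPolytope P := hw.2.subset rfl
  obtain ⟨x, hx⟩ : ∃ x, w x ≠ 0 := by
    by_contra! h
    exact h0 (funext h)
  have hxpos : 0 < w x := lt_of_le_of_ne (hwC.1 x) hx.symm
  have hsingle : ∀ y, 0 ≤ (Pi.single x (w x) : P → ℝ) y ∧ (Pi.single x (w x) : P → ℝ) y ≤ w y := by
    intro y
    rcases eq_or_ne y x with rfl | h
    · simp [hxpos.le]
    · simpa [h] using hwC.1 y
  have hb : (Pi.single x (w x) : P → ℝ) ∈ chainPolytope P :=
    mem_chainPolytope_of_le hwC (fun y => (hsingle y).1) fun y => (hsingle y).2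
  have hc : w - Pi.single x (w x) ∈ chainPolytope P :=
    mem_chainPolytope_of_le hwC (fun y => sub_nonneg.2 (hsingle y).2)
      fun y => sub_le_self _ (hsingle y).1
  have hmid : (2⁻¹ : ℝ) • w ∈ segment ℝ 0 w :=
    ⟨2⁻¹, 2⁻¹, by norm_num, by norm_num, by norm_num, by simp⟩
  -- Splitting off one coordinate writes the midpoint of the edge as the midpoint of two points of
  -- the polytope. Both must lie on the edge, so `w` has only that coordinate.
  have hopen : (2⁻¹ : ℝ) • w ∈ openSegment ℝ (Pi.single x (w x)) (w - Pi.single x (w x)) :=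
    ⟨2⁻¹, 2⁻¹, by norm_num, by norm_num, by norm_num, by rw [← smul_add, add_sub_cancel]⟩
  obtain ⟨s, t, -, -, -, hst⟩ :=
    hface.2.isExtreme.left_mem_of_mem_openSegment hb hc hmid hopen
  have hw' : w = Pi.single x (w x) := by
    have h1 := congrFun hst x
    simp only [smul_zero, zero_add, Pi.smul_apply, smul_eq_mul, Pi.single_eq_same] at h1
    have ht : t = 1 := by
      have : (t - 1) * w x = 0 := by linarith
      rcases mul_eq_zero.1 this with h | h
      · linarith
      · exact absurd h hx
    rw [← hst, ht]; simp
  refine ⟨x, ?_⟩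
  have hle : w x ≤ 1 := by
    have := sum_le_one_of_mem_chainPolytope hwC (s := {x}) (by simp)
    simpa using this
  rcases hle.eq_or_lt with h | h
  · rwa [h] at hw'
  · exfalso
    have hopen : w ∈ openSegment ℝ (0 : P → ℝ) (Pi.single x 1) := by
      refine ⟨1 - w x, w x, by linarith, hxpos, by ring, ?_⟩
      conv_rhs => rw [hw']
      ext y
      rcases eq_or_ne y x with rfl | h
      · simp
      · simp [h]
    exact h0 (hw.2.isExtreme.left_mem_of_mem_openSegment zero_mem_chainPolytope
      (single_mem_chainPolytope x) rfl hopen).symm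

theorem exists_mem_degreeSequence_chainPolytope_le [Finite P] :
    ∃ n ∈ degreeSequence (oneSkeleton (chainPolytope P)), n ≤ Nat.card P := by
  classical
  let o : polytopeVertices (chainPolytope P) := ⟨0, zero_mem_polytopeVertices_chainPolytope⟩
  refine ⟨_, mem_degreeSequence.2 ⟨o, rfl⟩, ?_⟩
  have h : ∀ w : (oneSkeleton (chainPolytope P)).neighborSet o,
      ∃ x, w.1.1 = Pi.single x 1 := fun w =>
    exists_eq_single_of_adj_zero w.1.2 (fun h => w.2.1 (Subtype.ext h.symm)) w.2.2
  choose f hf using h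
  refine Nat.card_le_card_of_injective f fun u v huv => Subtype.ext (Subtype.ext ?_)
  rw [hf, hf, huv]

/-- `v` is the midpoint of `min 1 (2v)` and `max 0 (2v - 1)`. Both stay in the polytope, being
monotone functions of `v` with values in `[0, 1]`, so a vertex equals both. -/
theorem eq_zero_or_eq_one_of_mem_vertices_orderPolytope {v : P → ℝ}
    (hv : v ∈ polytopeVertices (orderPolytope P)) (x : P) : v x = 0 ∨ v x = 1 := by
  have hvO : v ∈ orderPolytope P := hv.2.subset rfl
  have h1 : (fun y => min 1 (2 * v y)) ∈ orderPolytope P := by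
    refine ⟨fun y => ⟨le_min zero_le_one (by linarith [(hvO.1 y).1]), min_le_left _ _⟩,
      fun y z h => ?_⟩
    exact min_le_min_left _ (by linarith [hvO.2 y z h])
  have h2 : (fun y => max 0 (2 * v y - 1)) ∈ orderPolytope P := by
    refine ⟨fun y => ⟨le_max_left _ _, max_le zero_le_one (by linarith [(hvO.1 y).2])⟩,
      fun y z h => ?_⟩
    exact max_le_max_left _ (by linarith [hvO.2 y z h])
  have hopen : v ∈ openSegment ℝ (fun y => min 1 (2 * v y)) (fun y => max 0 (2 * v y - 1)) := by
    refine ⟨2⁻¹, 2⁻¹, by norm_num, by norm_num, by norm_num, ?_⟩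
    ext y
    simp only [Pi.add_apply, Pi.smul_apply, smul_eq_mul]
    rcases le_total 1 (2 * v y) with h | h
    · rw [min_eq_left h, max_eq_right (by linarith)]; ring
    · rw [min_eq_right h, max_eq_left (by linarith)]; ring
  have h3 := congrFun (hv.2.isExtreme.left_mem_of_mem_openSegment h1 h2 rfl hopen) x
  beta_reduce at h3
  rcases le_total 1 (2 * v x) with h | h
  · rw [min_eq_left h] at h3; exact Or.inr h3.symm
  · rw [min_eq_right h] at h3; left; linarith

theorem exists_isLowerSet_of_mem_vertices_orderPolytope {v : P → ℝ}
    (hv : v ∈ polytopeVertices (orderPolytope P)) :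
    ∃ I : Set P, IsLowerSet I ∧ v = I.indicator 1 := by
  classical
  have hvO : v ∈ orderPolytope P := hv.2.subset rfl
  refine ⟨{x | v x = 1}, fun x y hyx hx => ?_, funext fun x => ?_⟩
  · exact le_antisymm (hvO.1 y).2 ((show v x = 1 from hx) ▸ hvO.2 y x hyx)
  · by_cases h : v x = 1
    · simp [Set.indicator, h]
    · simp [Set.indicator,
        (eq_zero_or_eq_one_of_mem_vertices_orderPolytope hv x).resolve_right h]

/-- A function that is constant along comparabilities in `D` is constant on `D`. -/
def IsComparabilityConnected (D : Set P) : Prop :=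
  ∀ a : P → ℝ, (∀ x ∈ D, ∀ y ∈ D, x ≤ y → a x = a y) → ∀ x ∈ D, ∀ y ∈ D, a x = a y

theorem indicator_mem_orderPolytope {I : Set P} (hI : IsLowerSet I) :
    I.indicator (1 : P → ℝ) ∈ orderPolytope P := by
  classical
  refine ⟨fun x => ?_, fun x y hxy => ?_⟩
  · by_cases h : x ∈ I <;> simp [h]
  · by_cases hy : y ∈ I
    · simp [hy, hI hxy hy]
    · by_cases hx : x ∈ I <;> simp [hx, hy]

theorem convex_orderPolytope (P : Type*) [PartialOrder P] [Finite P] :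
    Convex ℝ (orderPolytope P) := by
  rw [orderPolytope_eq_setOf_forall_le]
  exact convex_setOf_forall_le _ _

/-- Nested lower sets with connected difference span a face of the order polytope. -/
theorem isPolytopeFace_orderPolytope_segment [Finite P] {I J : Set P} (hI : IsLowerSet I)
    (hJ : IsLowerSet J) (hIJ : I ⊆ J) (hconn : IsComparabilityConnected (J \ I)) :
    IsPolytopeFace (orderPolytope P) (segment ℝ (I.indicator 1) (J.indicator 1)) := by
  classical
  have := Fintype.ofFinite P
  let l : (I ⊕ ↑(Jᶜ) ⊕ {p : P × P // p.1 ∈ J \ I ∧ p.2 ∈ J \ I ∧ p.1 ≤ p.2}) →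
      (P → ℝ) →ₗ[ℝ] ℝ :=
    Sum.elim (fun x => LinearMap.proj x.1) (Sum.elim (fun x => -LinearMap.proj x.1)
      (fun p => LinearMap.proj (R := ℝ) (φ := fun _ : P => ℝ) p.1.2 -
        LinearMap.proj (R := ℝ) (φ := fun _ : P => ℝ) p.1.1))
  let c : (I ⊕ ↑(Jᶜ) ⊕ {p : P × P // p.1 ∈ J \ I ∧ p.2 ∈ J \ I ∧ p.1 ≤ p.2}) → ℝ :=
    Sum.elim (fun _ => 1) (fun _ => 0)
  refine isPolytopeFace_of_forall_linearMap_le ⟨_, left_mem_segment _ _ _⟩ l c ?_ fun a => ?_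
  · rintro (x | x | p) a ha
    · exact (ha.1 x.1).2
    · simpa [l, c] using (ha.1 x.1).1
    · simpa [l, c] using ha.2 _ _ p.2.2.2
  · constructor
    · intro ha
      refine ⟨(convex_orderPolytope P).segment_subset (indicator_mem_orderPolytope hI)
        (indicator_mem_orderPolytope hJ) ha, ?_⟩
      obtain ⟨s, t, -, -, hst, rfl⟩ := ha
      rintro (x | x | p)
      · simp [l, c, x.2, hIJ x.2, hst]
      · have h1 : x.1 ∉ J := x.2
        have h2 : x.1 ∉ I := fun h => h1 (hIJ h)
        simp [l, c, h1, h2]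
      · simp [l, c, p.2.1.1, p.2.1.2, p.2.2.1.1, p.2.2.1.2]
    -- Tightness fixes `a` to be 1 on `I` and 0 off `J`; connectedness leaves one free value `t` on
    -- `J \ I`, the parameter of the segment.
    · rintro ⟨ha, htight⟩
      have h1 : ∀ x ∈ I, a x = 1 := fun x hx => by simpa [l, c] using htight (Sum.inl ⟨x, hx⟩)
      have h2 : ∀ x ∉ J, a x = 0 := fun x hx => by
        simpa [l, c] using htight (Sum.inr (Sum.inl ⟨x, hx⟩))
      have h3 : ∀ x ∈ J \ I, ∀ y ∈ J \ I, a x = a y := hconn a fun x hx y hy hxy => by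
        have := htight (Sum.inr (Sum.inr ⟨(x, y), hx, hy, hxy⟩))
        simp only [l, c, Sum.elim_inr, LinearMap.sub_apply, LinearMap.coe_proj,
          Function.eval] at this
        linarith
      obtain ⟨t, ht0, ht1, ht⟩ : ∃ t : ℝ, 0 ≤ t ∧ t ≤ 1 ∧ ∀ x ∈ J \ I, a x = t := by
        rcases (J \ I).eq_empty_or_nonempty with h | ⟨z, hz⟩
        · exact ⟨0, le_rfl, zero_le_one, fun x hx => by simp [h] at hx⟩
        · exact ⟨a z, (ha.1 z).1, (ha.1 z).2, fun x hx => h3 x hx z hz⟩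
      refine ⟨1 - t, t, by linarith, ht0, by ring, funext fun x => ?_⟩
      by_cases hxI : x ∈ I
      · simp [hxI, hIJ hxI, h1 x hxI]
      · by_cases hxJ : x ∈ J
        · simp [hxI, hxJ, ht x ⟨hxJ, hxI⟩]
        · simp [hxI, hxJ, h2 x hxJ]

theorem indicator_mem_vertices_orderPolytope [Finite P] {I : Set P} (hI : IsLowerSet I) :
    I.indicator (1 : P → ℝ) ∈ polytopeVertices (orderPolytope P) := by
  have h := isPolytopeFace_orderPolytope_segment hI hI subset_rfl fun a _ x hx => by
    simp at hx
  rwa [segment_same] at h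

theorem isComparabilityConnected_of_exists {D : Set P} (h : ∃ z ∈ D, ∀ x ∈ D,
    ∃ y ∈ D, (x ≤ y ∨ y ≤ x) ∧ (y ≤ z ∨ z ≤ y)) : IsComparabilityConnected D := by
  obtain ⟨z, hz, h⟩ := h
  intro a ha
  have hsymm : ∀ x ∈ D, ∀ y ∈ D, (x ≤ y ∨ y ≤ x) → a x = a y := fun x hx y hy hxy =>
    hxy.elim (ha x hx y hy) fun h => (ha y hy x hx h).symm
  have key : ∀ x ∈ D, a x = a z := fun x hx => by
    obtain ⟨y, hy, hxy, hyz⟩ := h x hx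
    exact (hsymm x hx y hy hxy).trans (hsymm y hy z hz hyz)
  exact fun x hx y hy => (key x hx).trans (key y hy).symm

/-- A connected nonempty set that can be added to or removed from the lower set `I`. -/
structure IsLowerSetMove (I D : Set P) : Prop where
  nonempty : D.Nonempty
  isLowerSet : IsLowerSet (symmDiff I D)
  connected : IsComparabilityConnected D
  subset : D ⊆ I ∨ D ⊆ Iᶜ

theorem IsLowerSetMove.isPolytopeFace [Finite P] {I D : Set P} (hI : IsLowerSet I)
    (h : IsLowerSetMove I D) :
    IsPolytopeFace (orderPolytope P)
      (segment ℝ (I.indicator 1) ((symmDiff I D).indicator 1)) := by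
  rcases h.subset with hD | hD
  · have h1 : symmDiff I D = I \ D := symmDiff_of_ge hD
    have h2 := h.isLowerSet
    rw [h1] at h2 ⊢
    rw [segment_symm]
    refine isPolytopeFace_orderPolytope_segment h2 hI Set.sdiff_subset ?_
    rw [Set.sdiff_sdiff_cancel_left hD]
    exact h.connected
  · have hdisj : Disjoint I D := (Set.subset_compl_iff_disjoint_left.1 hD)
    have h1 : symmDiff I D = I ∪ D := hdisj.symmDiff_eq_sup
    have h2 := h.isLowerSet
    rw [h1] at h2 ⊢
    refine isPolytopeFace_orderPolytope_segment hI h2 Set.subset_union_left ?_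
    rw [Set.union_sdiff_cancel_left (Set.disjoint_iff.1 hdisj)]
    exact h.connected

/-- Distinct moves lead to distinct neighbours because `symmDiff I` is injective. -/
theorem card_le_card_neighborSet_orderPolytope [Finite P] {I : Set P} (hI : IsLowerSet I)
    {T : Type*} (D : T → Set P) (hD : Function.Injective D) (hmove : ∀ t, IsLowerSetMove I (D t))
    (v : polytopeVertices (orderPolytope P)) (hv : v.1 = I.indicator 1) :
    Nat.card T ≤ Nat.card ((oneSkeleton (orderPolytope P)).neighborSet v) := by
  have hind : ∀ A B : Set P, A.indicator (1 : P → ℝ) = B.indicator 1 → A = B := fun A B h =>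
    Set.indicator_one_inj ℝ h
  let f : T → (oneSkeleton (orderPolytope P)).neighborSet v := fun t =>
    ⟨⟨_, indicator_mem_vertices_orderPolytope (hmove t).isLowerSet⟩, by
      refine ⟨fun h => ?_, ?_⟩
      · have h1 := congrArg Subtype.val h
        rw [hv] at h1
        have h2 := hind _ _ h1
        have h3 := symmDiff_eq_left.1 h2.symm
        exact (hmove t).nonempty.ne_empty h3
      · rw [hv]
        exact (hmove t).isPolytopeFace hI⟩
  refine Nat.card_le_card_of_injective f fun s t hst => hD ?_
  have h1 := hind _ _ (congrArg (fun w => w.1.1) hst)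
  exact symmDiff_right_injective I h1

theorem isLowerSetMove_of_isUpperSet {I U : Set P} (hI : IsLowerSet I) (hU : IsUpperSet U)
    (hne : (I ∩ U).Nonempty) (hconn : IsComparabilityConnected (I ∩ U)) :
    IsLowerSetMove I (I ∩ U) where
  nonempty := hne
  isLowerSet := by
    rw [symmDiff_of_ge (a := I) (b := I ∩ U) Set.inter_subset_left]
    change IsLowerSet (I \ (I ∩ U))
    rw [Set.sdiff_self_inter]
    intro x y hyx hx
    exact ⟨hI hyx hx.1, fun hy => hx.2 (hU hyx hy)⟩
  connected := hconn
  subset := Or.inl Set.inter_subset_left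

theorem isLowerSetMove_of_isLowerSet {I L : Set P} (hI : IsLowerSet I) (hL : IsLowerSet L)
    (hne : (L \ I).Nonempty) (hconn : IsComparabilityConnected (L \ I)) :
    IsLowerSetMove I (L \ I) where
  nonempty := hne
  isLowerSet := by
    have : symmDiff I (L \ I) = I ∪ L := by
      rw [(Set.disjoint_sdiff_right).symmDiff_eq_sup]
      exact Set.union_sdiff_self
    rw [this]
    exact hI.union hL
  connected := hconn
  subset := Or.inr fun x hx => hx.2

open Classical in
/-- The part of `I` above `x` if `x ∈ I`, the part of the complement below `x` otherwise. -/
noncomputable def principalMove (I : Set P) (x : P) : Set P :=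
  if x ∈ I then I ∩ Set.Ici x else Set.Iic x \ I

theorem principalMove_of_mem {I : Set P} {x : P} (h : x ∈ I) :
    principalMove I x = I ∩ Set.Ici x := if_pos h

theorem principalMove_of_notMem {I : Set P} {x : P} (h : x ∉ I) :
    principalMove I x = Set.Iic x \ I := if_neg h

theorem mem_principalMove (I : Set P) (x : P) : x ∈ principalMove I x := by
  by_cases h : x ∈ I
  · rw [principalMove_of_mem h]; exact ⟨h, le_rfl⟩
  · rw [principalMove_of_notMem h]; exact ⟨le_rfl, h⟩

theorem isLowerSetMove_principalMove {I : Set P} (hI : IsLowerSet I) (x : P) :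
    IsLowerSetMove I (principalMove I x) := by
  have hx := mem_principalMove I x
  by_cases h : x ∈ I
  · rw [principalMove_of_mem h] at hx ⊢
    exact isLowerSetMove_of_isUpperSet hI (isUpperSet_Ici x) ⟨x, hx⟩
      (isComparabilityConnected_of_exists ⟨x, hx, fun y hy =>
        ⟨x, hx, Or.inr hy.2, Or.inl le_rfl⟩⟩)
  · rw [principalMove_of_notMem h] at hx ⊢
    exact isLowerSetMove_of_isLowerSet hI (isLowerSet_Iic x) ⟨x, hx⟩
      (isComparabilityConnected_of_exists ⟨x, hx, fun y hy =>
        ⟨x, hx, Or.inl hy.1, Or.inl le_rfl⟩⟩)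

theorem mem_iff_of_mem_principalMove {I : Set P} {x y : P} (h : y ∈ principalMove I x) :
    y ∈ I ↔ x ∈ I := by
  by_cases hx : x ∈ I
  · rw [principalMove_of_mem hx] at h; exact ⟨fun _ => hx, fun _ => h.1⟩
  · rw [principalMove_of_notMem hx] at h; exact ⟨fun hy => absurd hy h.2, fun h => absurd h hx⟩

/-- The generator is recovered as the least element of the move if it lies in `I`, and as the
greatest otherwise. -/
theorem principalMove_injective (I : Set P) : Function.Injective (principalMove I) := by
  intro x y h
  have h1 : x ∈ principalMove I y := h ▸ mem_principalMove I x
  have h2 : y ∈ principalMove I x := h ▸ mem_principalMove I y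
  have h3 := mem_iff_of_mem_principalMove h1
  by_cases hx : x ∈ I
  · rw [principalMove_of_mem (h3.1 hx)] at h1
    rw [principalMove_of_mem hx] at h2
    exact le_antisymm h2.2 h1.2
  · rw [principalMove_of_notMem (fun h => hx (h3.2 h))] at h1
    rw [principalMove_of_notMem hx] at h2
    exact le_antisymm h1.1 h2.1

/-- If `X` occurs in `P`, some move of a given lower set is not principal. -/
theorem exists_isLowerSetMove_not_principal {I : Set P} (hI : IsLowerSet I)
    (hX : Nonempty (PosetX ↪o P)) : ∃ D, IsLowerSetMove I D ∧ ∀ x, principalMove I x ≠ D := by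
  obtain ⟨a, hd, hu⟩ := nonempty_posetX_orderEmbedding_iff.1 hX
  -- If `a ∈ I`, remove the part of `I` above `d` or `e`; otherwise add everything missing below `b`
  -- or `c`. Either piece is connected through `a`, but has no least, respectively greatest,
  -- element, so it is not principal.
  by_cases ha : a ∈ I
  · obtain ⟨d, hda, e, hea, hde, hed⟩ := not_isChain_iff_exists_incomparable.1 hd
    have hda : d ≤ a := le_of_lt hda
    have hea : e ≤ a := le_of_lt hea
    have hdD : d ∈ I ∩ (Set.Ici d ∪ Set.Ici e) := ⟨hI hda ha, Or.inl le_rfl⟩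
    have heD : e ∈ I ∩ (Set.Ici d ∪ Set.Ici e) := ⟨hI hea ha, Or.inr le_rfl⟩
    refine ⟨I ∩ (Set.Ici d ∪ Set.Ici e), isLowerSetMove_of_isUpperSet hI
      ((isUpperSet_Ici d).union (isUpperSet_Ici e)) ⟨d, hdD⟩
      (isComparabilityConnected_of_exists ⟨a, ⟨ha, Or.inl hda⟩, ?_⟩), fun x hx => ?_⟩
    · rintro y ⟨-, hy | hy⟩
      · exact ⟨d, hdD, Or.inr hy, Or.inl hda⟩
      · exact ⟨e, heD, Or.inr hy, Or.inl hea⟩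
    · have h1 := mem_principalMove I x
      rw [hx] at h1
      rw [principalMove_of_mem h1.1] at hx
      have h2 : x ≤ d := (hx ▸ hdD : d ∈ I ∩ Set.Ici x).2
      have h3 : x ≤ e := (hx ▸ heD : e ∈ I ∩ Set.Ici x).2
      rcases h1.2 with h | h
      · exact hde (le_trans h h3)
      · exact hed (le_trans h h2)
  · obtain ⟨b, hba, c, hca, hbc, hcb⟩ := not_isChain_iff_exists_incomparable.1 hu
    have hba : a ≤ b := le_of_lt hba
    have hca : a ≤ c := le_of_lt hca
    have hbD : b ∈ (Set.Iic b ∪ Set.Iic c) \ I := ⟨Or.inl le_rfl, fun h => ha (hI hba h)⟩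
    have hcD : c ∈ (Set.Iic b ∪ Set.Iic c) \ I := ⟨Or.inr le_rfl, fun h => ha (hI hca h)⟩
    refine ⟨(Set.Iic b ∪ Set.Iic c) \ I, isLowerSetMove_of_isLowerSet hI
      ((isLowerSet_Iic b).union (isLowerSet_Iic c)) ⟨b, hbD⟩
      (isComparabilityConnected_of_exists ⟨a, ⟨Or.inl hba, ha⟩, ?_⟩), fun x hx => ?_⟩
    · rintro y ⟨hy | hy, -⟩
      · exact ⟨b, hbD, Or.inl hy, Or.inr hba⟩
      · exact ⟨c, hcD, Or.inl hy, Or.inr hca⟩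
    · have h1 := mem_principalMove I x
      rw [hx] at h1
      rw [principalMove_of_notMem h1.2] at hx
      have h2 : b ≤ x := (hx ▸ hbD : b ∈ Set.Iic x \ I).1
      have h3 : c ≤ x := (hx ▸ hcD : c ∈ Set.Iic x \ I).1
      rcases h1.1 with h | h
      · exact hcb (le_trans h3 h)
      · exact hbc (le_trans h2 h)

theorem card_lt_of_mem_degreeSequence_orderPolytope [Finite P] (hX : Nonempty (PosetX ↪o P))
    {n : ℕ} (hn : n ∈ degreeSequence (oneSkeleton (orderPolytope P))) : Nat.card P < n := by
  obtain ⟨v, rfl⟩ := mem_degreeSequence.1 hn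
  obtain ⟨I, hI, hv⟩ := exists_isLowerSet_of_mem_vertices_orderPolytope v.2
  obtain ⟨D, hD, hDx⟩ := exists_isLowerSetMove_not_principal hI hX
  -- `none` indexes the extra move, so there are `|P| + 1` distinct neighbours.
  have h := card_le_card_neighborSet_orderPolytope hI (T := Option P)
    (fun o => o.elim D (principalMove I)) ?_ ?_ v hv
  · rwa [Finite.card_option] at h
  · rintro (_ | x) (_ | y) h
    · rfl
    · exact absurd h.symm (hDx y)
    · exact absurd h (hDx x)
    · exact congrArg some (principalMove_injective I h)
  · rintro (_ | x)
    · exact hD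
    · exact isLowerSetMove_principalMove hI x

theorem degreeSequence_ne_of_posetX [Finite P] (hX : Nonempty (PosetX ↪o P)) :
    degreeSequence (oneSkeleton (orderPolytope P)) ≠
      degreeSequence (oneSkeleton (chainPolytope P)) := by
  intro h
  obtain ⟨n, hn, hle⟩ := exists_mem_degreeSequence_chainPolytope_le (P := P)
  exact (card_lt_of_mem_degreeSequence_orderPolytope hX (h ▸ hn)).not_ge hle

end DegreeSequences

/-- The last condition says that `X` does not occur in `P` as a subposet with the induced order. -/
theorem corollary3p2 (P : Type*) [PartialOrder P] [Fintype P] [DecidableEq P] :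
    List.TFAE [
      UnimodularlyEquivalent (orderPolytope P) (chainPolytope P),
      AffinelyEquivalent (orderPolytope P) (chainPolytope P),
      fVector (orderPolytope P) = fVector (chainPolytope P),
      facetNumber (orderPolytope P) = facetNumber (chainPolytope P),
      degreeSequence (oneSkeleton (orderPolytope P)) =
        degreeSequence (oneSkeleton (chainPolytope P)),
      ¬ Nonempty (PosetX ↪o P)] := by
  tfae_have 1 → 2 := UnimodularlyEquivalent.affinelyEquivalent
  tfae_have 2 → 3 := AffinelyEquivalent.fVector_eq
  tfae_have 3 → 4 := facetNumber_eq_of_fVector_eq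
  tfae_have 4 → 6 := fun h hX => (facetNumber_orderPolytope_lt_of_posetX hX).ne h
  tfae_have 6 → 1 := unimodularlyEquivalent_of_not_posetX
  tfae_have 2 → 5 := AffinelyEquivalent.degreeSequence_eq
  tfae_have 5 → 6 := fun h hX => degreeSequence_ne_of_posetX hX h
  tfae_finish
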